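/- Let $C$ be a finite set of candidates. A weak order $v$ on $C$ is given by a strict preference relation $>$ that is irreflexive and transitive and whose indifference relation ($a\sim b$ iff neither $a>b$ nor $b>a$) is transitive. An axis is a total ordering $A$ of $C$. A profile (finite multiset) $V$ of weak orders on $C$ is \emph{single-peaked} (Black) if there is one axis $A$ such that every $v\in V$ has a unique most preferred candidate $p$ (the peak), and splitting $A$ at $p$ gives a segment $X$ to the left of $p$ along which $v$ is strictly increasing and a segment $Y$ to the right of $p$ along which $v$ is strictly decreasing ($X$ and $Y$ may be empty). Then the problem of determining whether a given profile of weak orders is single-peaked is in $\mathrm{P}$: writing a profile with $n$ candidates and $m$ voters as the binary word $1^n0\,1^m0\,M_1\cdots M_m$, where $M_i$ is the $n\times n$ $0$-$1$ matrix (row by row) of the strict preference relation of the $i$-th voter, there is a Turing machine that, on every binary word $x$, decides in time polynomial in $|x|$ whether $x$ is the code of a single-peaked profile of weak orders. -/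

import Mathlib

/-! ### The complexity class P -/

/-- The language `L` is in P: some Turing machine, started on any word `x` over the input alphabet,
halts within `q(|x|)` steps for a fixed polynomial `q`, and its output is the bit telling whether
`x ∈ L`. The machines are the multi-stack Turing machines of Mathlib, with finitely many
stacks, finitely many labels and finitely many internal states; all stack alphabets are finite. -/
def InP {Γ : Type} (L : Language Γ) : Prop :=
  ∃ f : List Γ → Bool, (∀ x, f x = true ↔ x ∈ L) ∧
    ∃ M : Turing.TM2ComputableInPolyTime (id : List Γ → List Γ) Computability.encodeBool f,
      ∀ k, Finite (M.tm.Γ k)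

/-! ### Weak orders and single-peaked profiles -/

/-- A weak order on the candidate set `C`, given by its strict part: `v.prefers a b` means `a > b`.
Candidates none of which is preferred to the other are indifferent, and indifference is
transitive. -/
@[ext]
structure WeakOrder (C : Type) where
  /-- strict preference -/
  prefers : C → C → Prop
  irrefl : ∀ a, ¬ prefers a a
  trans : ∀ a b c, prefers a b → prefers b c → prefers a c
  indiff_trans : ∀ a b c, (¬ prefers a b ∧ ¬ prefers b a) → (¬ prefers b c ∧ ¬ prefers c b) →
    (¬ prefers a c ∧ ¬ prefers c a)

namespace WeakOrder

variable {C : Type}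

/-- `p` is the peak of `v`: the single most preferred candidate. -/
def IsPeak (v : WeakOrder C) (p : C) : Prop :=
  ∀ c, c ≠ p → v.prefers p c

/-- The axis `A` (a listing of the candidates from left to right) can be split at the peak of `v`
into a segment `X` to the left, along which `v` is strictly increasing, and a segment `Y` to the
right, along which `v` is strictly decreasing. -/
def SinglePeakedOn (v : WeakOrder C) (A : List C) : Prop :=
  ∃ (p : C) (X Y : List C), v.IsPeak p ∧ A = X ++ p :: Y ∧
    X.Pairwise (fun a b => v.prefers b a) ∧ Y.Pairwise (fun a b => v.prefers a b)

end WeakOrder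

/-- An axis: a total ordering of the candidates, as the list of all candidates without
repetition. -/
def IsAxis {C : Type} (A : List C) : Prop :=
  A.Nodup ∧ ∀ c : C, c ∈ A

/-- A preference profile (a multiset of weak orders) is single-peaked if there is one axis on
which every voter is single-peaked. -/
def SinglePeaked {C : Type} (V : Multiset (WeakOrder C)) : Prop :=
  ∃ A : List C, IsAxis A ∧ ∀ v ∈ V, v.SinglePeakedOn A

/-! ### The decision problem -/

/-- A finite candidate set, numbered `0, …, numCandidates - 1`, and a list of voters. -/
structure ProfileInput where
  numCandidates : ℕ
  voters : List (WeakOrder (Fin numCandidates))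

open scoped Classical in
/-- A voter is written as the 0-1 matrix, row by row, of the strict preference relation. -/
noncomputable def WeakOrder.encode {n : ℕ} (v : WeakOrder (Fin n)) : List Bool :=
  (List.finRange n).flatMap fun a => (List.finRange n).map fun b => decide (v.prefers a b)

/-- A profile is written as the binary word `1ⁿ 0 1ᵐ 0 M₁ … Mₘ`, where `n` is the number of
candidates, `m` is the number of voters, and `Mᵢ` is the matrix of the `i`-th voter. -/
noncomputable def ProfileInput.encode (I : ProfileInput) : List Bool :=
  List.replicate I.numCandidates true ++ false ::
    (List.replicate I.voters.length true ++ false ::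
      I.voters.flatMap WeakOrder.encode)

/-- The binary words that describe a single-peaked profile of weak orders. -/
def singlePeakedLanguage : Language Bool :=
  {x | ∃ I : ProfileInput,
    SinglePeaked (I.voters : Multiset (WeakOrder (Fin I.numCandidates))) ∧ I.encode = x}

/-! ### Different profiles have different codes -/

theorem WeakOrder.encode_length {n : ℕ} (v : WeakOrder (Fin n)) : v.encode.length = n * n := by
  simp [WeakOrder.encode, List.length_flatMap]

theorem WeakOrder.encode_injective {n : ℕ} :
    Function.Injective (WeakOrder.encode : WeakOrder (Fin n) → List Bool) := by
  intro v w h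
  have key : ∀ (l k : List (Fin n)) (f g : Fin n → Fin n → Bool),
      (l.flatMap fun a => k.map fun b => f a b) = (l.flatMap fun a => k.map fun b => g a b) →
      ∀ a ∈ l, ∀ b ∈ k, f a b = g a b := by
    intro l k f g
    induction l with
    | nil => simp
    | cons x l ih =>
      intro h
      rw [List.flatMap_cons, List.flatMap_cons] at h
      obtain ⟨h1, h2⟩ := List.append_inj h (by simp)
      intro a ha b hb
      rcases List.mem_cons.1 ha with rfl | ha
      · exact List.map_inj_left.1 h1 b hb
      · exact ih h2 a ha b hb
  ext a b
  have := key _ _ _ _ h a (List.mem_finRange a) b (List.mem_finRange b)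
  simpa using this

theorem ProfileInput.encode_injective : Function.Injective ProfileInput.encode := by
  have unary : ∀ (a b : ℕ) (s t : List Bool),
      List.replicate a true ++ false :: s = List.replicate b true ++ false :: t →
      a = b ∧ s = t := by
    intro a
    induction a with
    | zero => intro b s t h; cases b <;> simp_all [List.replicate_succ]
    | succ a ih =>
      intro b s t h
      cases b with
      | zero => simp [List.replicate_succ] at h
      | succ b =>
        simp only [List.replicate_succ, List.cons_append, List.cons.injEq, true_and] at h
        obtain ⟨h1, h2⟩ := ih b s t h
        exact ⟨by rw [h1], h2⟩
  have blocks : ∀ (n : ℕ) (l k : List (WeakOrder (Fin n))), l.length = k.length →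
      l.flatMap WeakOrder.encode = k.flatMap WeakOrder.encode → l = k := by
    intro n l
    induction l with
    | nil => intro k hk _; exact (List.length_eq_zero_iff.1 hk.symm).symm
    | cons x l ih =>
      intro k hk h
      cases k with
      | nil => simp at hk
      | cons y k =>
        rw [List.flatMap_cons, List.flatMap_cons] at h
        obtain ⟨h1, h2⟩ := List.append_inj h (by simp [WeakOrder.encode_length])
        rw [WeakOrder.encode_injective h1, ih k (by simpa using hk) h2]
  rintro ⟨n, l⟩ ⟨n', l'⟩ h
  obtain ⟨h1, h2⟩ := unary _ _ _ _ h
  obtain ⟨h3, h4⟩ := unary _ _ _ _ h2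
  dsimp only at h1 h3 h4
  subst h1
  rw [blocks n l l' h3 h4]

/-! Combinatorially, fix a reference voter `v`. On an axis for the profile every candidate lies on
one of the two sides of the peak of `v`, and these sides determine the axis, because `v` must be
strictly increasing on the left and strictly decreasing on the right. Finding an axis is therefore
finding a two-colouring of the candidates. A voter with a peak is single-peaked on an axis exactly
when no candidate lies between two others without being preferred to at least one of them (no
valley).

Let `a`, `b`, `c` be candidates with `rank a ≤ rank b ≤ rank c` for `v`. On an axis built from
sides, with indifferent candidates on different sides, `a` is never between the other two, `b` is in
the middle if `a` and `b` share a side, and `c` is in the middle if they do not. So each valley to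
be avoided, for any voter, says that one pair of candidates must differ or must agree in colour.
`sides_of_singlePeaked` and `singlePeaked_of_sides` show that these constraints are necessary and,
together with the existence of peaks, sufficient. Such a system has a solution iff in the graph on
pairs (candidate, colour) no candidate has its two colours connected
(`reflTransGen_prod_bool_iff_coloring`), so single-peakedness is a reachability question
(`singlePeaked_iff_not_reachable`).

For the complexity bound, stack machines simulate heads on lists of `N = |x|` cells, and the
position of a head serves as a number at most `N`. `Realizes` is closed under composition, branching
and loops whose length is a head position, so every program built from these runs in polynomial
time. `Decides` inherits closure under connectives and bounded quantifiers, and `Decides.reach` adds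
graph reachability by marking bits. The properties "`x` is the code of a profile with peaks" and
"the constraints are consistent" are written with these means in terms of the bits of `x`, and
`inP_of_decides` turns the program into a machine as required by `InP`. -/

/-! ### Composable stack machines -/

open Turing

/-- The internal state of a fragment: a flag and a one-symbol buffer. -/
abbrev Reg := Bool × Option Bool

/-- A stack machine over a fixed family of stacks of bits. Halting means passing on control. -/
structure Frag (K : Type) where
  Λ : Type
  fin : Fintype Λ
  entry : Λ
  code : Λ → TM2.Stmt (fun _ : K => Bool) Λ Reg

namespace Frag

section Relabel

variable {K Λ Λ' : Type}

/-- Rename the labels of a statement, and replace halting by a jump to `e` if `e` is a label. -/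
def relabel (g : Λ → Λ') (e : Option Λ') :
    TM2.Stmt (fun _ : K => Bool) Λ Reg → TM2.Stmt (fun _ : K => Bool) Λ' Reg
  | .push k f q => .push k f (relabel g e q)
  | .peek k f q => .peek k f (relabel g e q)
  | .pop k f q => .pop k f (relabel g e q)
  | .load f q => .load f (relabel g e q)
  | .branch f q q' => .branch f (relabel g e q) (relabel g e q')
  | .goto f => .goto fun v => g (f v)
  | .halt => match e with
    | some l => .goto fun _ => l
    | none => .halt

variable [DecidableEq K]

theorem stepAux_relabel (g : Λ → Λ') (e : Option Λ') (q : TM2.Stmt (fun _ : K => Bool) Λ Reg)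
    (v : Reg) (S : K → List Bool) :
    TM2.stepAux (relabel g e q) v S =
      ⟨((TM2.stepAux q v S).l.map g).or e, (TM2.stepAux q v S).var, (TM2.stepAux q v S).stk⟩ := by
  induction q generalizing v S with
  | push k f q ih => exact ih _ _
  | peek k f q ih => exact ih _ _
  | pop k f q ih => exact ih _ _
  | load f q ih => exact ih _ _
  | branch f q q' ih ih' =>
    simp only [relabel, TM2.stepAux]
    cases f v
    · exact ih' _ _
    · exact ih _ _
  | goto f => rfl
  | halt => cases e <;> rfl

/-- `Steps M n c c'`: the machine `M` goes from `c` to `c'` in `n` steps. -/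
inductive Steps (M : Λ → TM2.Stmt (fun _ : K => Bool) Λ Reg) :
    ℕ → TM2.Cfg (fun _ : K => Bool) Λ Reg → TM2.Cfg (fun _ : K => Bool) Λ Reg → Prop
  | refl (c) : Steps M 0 c c
  | head {n l v S c} : Steps M n (TM2.stepAux (M l) v S) c → Steps M (n + 1) ⟨some l, v, S⟩ c

theorem Steps.trans {M : Λ → TM2.Stmt (fun _ : K => Bool) Λ Reg} {n n' c c' c''}
    (h : Steps M n c c') (h' : Steps M n' c' c'') : Steps M (n + n') c c'' := by
  induction h with
  | refl => simpa using h'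
  | head _ ih => rw [Nat.add_right_comm]; exact .head (ih h')

/-- The statement that used to halt is the one that now jumps to `e`, so composition costs no extra
step and running times simply add up. -/
theorem Steps.relabel {M : Λ → TM2.Stmt (fun _ : K => Bool) Λ Reg}
    {M' : Λ' → TM2.Stmt (fun _ : K => Bool) Λ' Reg} {g : Λ → Λ'} {e : Option Λ'}
    (hM : ∀ l, M' (g l) = Frag.relabel g e (M l)) {n c c'} (h : Steps M n c c') :
    ∀ l, c.l = some l → c'.l = none →
      Steps M' n ⟨some (g l), c.var, c.stk⟩ ⟨e, c'.var, c'.stk⟩ := by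
  induction h with
  | refl c => intro l h h'; simp [h] at h'
  | @head n l v S c h ih =>
    rintro _ ⟨⟩ hc
    refine .head ?_
    rw [hM, stepAux_relabel]
    cases hl : (TM2.stepAux (M l) v S).l with
    | some l' =>
      exact ih l' hl hc
    | none =>
      generalize TM2.stepAux (M l) v S = c₀ at h hl
      cases h with
      | refl => simpa using Steps.refl _
      | head => simp at hl

end Relabel

variable {K : Type} [DecidableEq K]

/-- The fragment `F`, started at its entry in the first state, halts in the second state after at
most `n` steps. -/
def Run (F : Frag K) (n : ℕ) (a b : Reg × (K → List Bool)) : Prop :=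
  ∃ k ≤ n, Steps F.code k ⟨some F.entry, a.1, a.2⟩ ⟨none, b.1, b.2⟩

theorem Run.mono {F : Frag K} {n n' a b} (h : F.Run n a b) (hn : n ≤ n') : F.Run n' a b :=
  let ⟨k, hk, h⟩ := h
  ⟨k, hk.trans hn, h⟩

/-- A single statement. -/
def atom (q : TM2.Stmt (fun _ : K => Bool) Unit Reg) : Frag K :=
  ⟨Unit, inferInstance, (), fun _ => q⟩

theorem run_atom {q : TM2.Stmt (fun _ : K => Bool) Unit Reg} {a b : Reg × (K → List Bool)}
    (h : TM2.stepAux q a.1 a.2 = ⟨none, b.1, b.2⟩) : (atom q).Run 1 a b :=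
  ⟨1, le_rfl, .head (by simpa only [atom, h] using Steps.refl _)⟩

/-- First `F`, then `G`. -/
def seq (F G : Frag K) : Frag K where
  Λ := F.Λ ⊕ G.Λ
  fin := letI := F.fin; letI := G.fin; inferInstance
  entry := .inl F.entry
  code := Sum.elim (fun l => relabel .inl (some (.inr G.entry)) (F.code l))
    (fun l => relabel .inr none (G.code l))

theorem run_seq {F G : Frag K} {n n' a b c} (h : F.Run n a b) (h' : G.Run n' b c) :
    (F.seq G).Run (n + n') a c := by
  obtain ⟨k, hk, h⟩ := h
  obtain ⟨k', hk', h'⟩ := h'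
  refine ⟨k + k', Nat.add_le_add hk hk', ?_⟩
  have e := h.relabel (M' := (F.seq G).code) (g := .inl) (e := some (.inr G.entry))
    (fun _ => rfl) _ rfl rfl
  have e' := h'.relabel (M' := (F.seq G).code) (g := .inr) (e := none)
    (fun _ => rfl) _ rfl rfl
  exact e.trans e'

/-- `F` if the flag is set, and `G` otherwise. -/
def ite (F G : Frag K) : Frag K where
  Λ := Option (F.Λ ⊕ G.Λ)
  fin := letI := F.fin; letI := G.fin; inferInstance
  entry := none
  code := fun o => o.elim
    (.goto fun v => if v.1 then some (.inl F.entry) else some (.inr G.entry))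
    (Sum.elim (fun l => relabel (some ∘ .inl) none (F.code l))
      (fun l => relabel (some ∘ .inr) none (G.code l)))

theorem run_ite_true {F G : Frag K} {n a b} (h : F.Run n a b) (ha : a.1.1 = true) :
    (F.ite G).Run (n + 1) a b := by
  obtain ⟨k, hk, h⟩ := h
  have e := h.relabel (M' := (F.ite G).code) (g := some ∘ .inl) (e := none)
    (fun _ => rfl) _ rfl rfl
  refine ⟨k + 1, Nat.add_le_add_right hk 1, .head ?_⟩
  simpa [Frag.ite, ha] using e

theorem run_ite_false {F G : Frag K} {n a b} (h : G.Run n a b) (ha : a.1.1 = false) :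
    (F.ite G).Run (n + 1) a b := by
  obtain ⟨k, hk, h⟩ := h
  have e := h.relabel (M' := (F.ite G).code) (g := some ∘ .inr) (e := none)
    (fun _ => rfl) _ rfl rfl
  refine ⟨k + 1, Nat.add_le_add_right hk 1, .head ?_⟩
  simpa [Frag.ite, ha] using e

/-- Pop symbols from the stack `k` into the buffer until it is empty, each time running `F`. -/
def whilePop (k : K) (F : Frag K) : Frag K where
  Λ := Option F.Λ
  fin := letI := F.fin; inferInstance
  entry := none
  code := fun o => o.elim
    (.pop k (fun v o => (v.1, o)) (.branch (fun v => v.2.isSome) (.goto fun _ => some F.entry) .halt))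
    (fun l => relabel some (some none) (F.code l))

theorem run_whilePop_nil {F : Frag K} {k : K} {v : Reg} {S : K → List Bool} (h : S k = []) :
    (whilePop k F).Run 1 (v, S) ((v.1, none), S) := by
  refine ⟨1, le_rfl, .head ?_⟩
  have : Function.update S k [] = S := by rw [← h]; simp
  simpa [whilePop, h, this] using Steps.refl _

theorem run_whilePop_cons {F : Frag K} {k : K} {v : Reg} {S : K → List Bool} {b : Bool}
    {l : List Bool} {n n' : ℕ} {c e : Reg × (K → List Bool)} (h : S k = b :: l)
    (hF : F.Run n ((v.1, some b), Function.update S k l) c) (hW : (whilePop k F).Run n' c e) :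
    (whilePop k F).Run (n + n' + 1) (v, S) e := by
  obtain ⟨j, hj, hF⟩ := hF
  obtain ⟨j', hj', hW⟩ := hW
  refine ⟨j + j' + 1, by omega, .head ?_⟩
  have e := hF.relabel (M' := (whilePop k F).code) (g := some) (e := some none)
    (fun _ => rfl) _ rfl rfl
  simpa [whilePop, h] using e.trans hW

end Frag

/-! ### Loop programs on bounded heads -/

open Turing

namespace Frag

variable {K : Type} [DecidableEq K]

/-- Each symbol costs one step for the pop and one for the push; the last step finds the stack
empty. -/
theorem run_whilePop_move {k k' : K} (hk : k' ≠ k) (l : List Bool) : ∀ (v : Reg)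
    (S : K → List Bool), S k = l →
    (whilePop k (atom (.push k' (fun v => v.2.getD false) (.load (fun v => (v.1, none)) .halt)))).Run
      (2 * l.length + 1) (v, S)
      ((v.1, none), Function.update (Function.update S k []) k' (l.reverse ++ S k')) := by
  induction l with
  | nil =>
    intro v S h
    have : Function.update (Function.update S k []) k' ([].reverse ++ S k') = S := by
      rw [← h, Function.update_eq_self]; simp [h]
    rw [this]
    exact run_whilePop_nil h
  | cons b l ih =>
    intro v S h
    have e := run_whilePop_cons h (v := v) (n := 1) (run_atom (b := ((v.1, none),
      Function.update (Function.update S k l) k' (b :: S k'))) (by simp [hk]))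
      (ih _ _ (by simp [hk.symm]))
    refine cast ?_ (e.mono (show _ ≤ 2 * (b :: l).length + 1 by simp; omega))
    congr 2
    funext j
    by_cases h1 : j = k'
    · subst h1; simp
    · by_cases h2 : j = k
      · subst h2; simp [h1]
      · simp [h1, h2]

/-- Following `run_whilePop_move`, this restores the moved stack and leaves a copy of it on a
counter, with as many symbols as the position of the head. -/
theorem run_whilePop_copy {k k' k'' : K} (hk : k' ≠ k) (hk' : k'' ≠ k) (hk'' : k'' ≠ k')
    (l : List Bool) : ∀ (v : Reg) (S : K → List Bool), S k = l →
    (whilePop k (atom (.push k' (fun v => v.2.getD false) (.push k'' (fun v => v.2.getD false)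
      (.load (fun v => (v.1, none)) .halt))))).Run
      (2 * l.length + 1) (v, S)
      ((v.1, none), Function.update (Function.update (Function.update S k []) k' (l.reverse ++ S k'))
        k'' (l.reverse ++ S k'')) := by
  induction l with
  | nil =>
    intro v S h
    have : Function.update (Function.update (Function.update S k []) k' ([].reverse ++ S k'))
        k'' ([].reverse ++ S k'') = S := by
      rw [← h, Function.update_eq_self]; simp [h]
    rw [this]
    exact run_whilePop_nil h
  | cons b l ih =>
    intro v S h
    have e := run_whilePop_cons h (v := v) (n := 1) (run_atom (b := ((v.1, none),
      Function.update (Function.update (Function.update S k l) k' (b :: S k')) k'' (b :: S k'')))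
      (by simp [hk, hk', hk'']))
      (ih _ _ (by simp [hk.symm, hk'.symm]))
    refine cast ?_ (e.mono (show _ ≤ 2 * (b :: l).length + 1 by simp; omega))
    congr 2
    funext j
    by_cases h0 : j = k''
    · subst h0; simp
    · by_cases h1 : j = k'
      · subst h1; simp [hk''.symm]
      · by_cases h2 : j = k
        · subst h2; simp [h1, h0]
        · simp [h1, h2, h0]

end Frag

/-- The contents of the heads: each head has a position on its own list of cells. -/
@[ext]
structure Mem (H : Type) where
  pos : H → ℕ
  cells : H → List Bool

namespace Mem

variable {H : Type}

/-- All lists of cells have length `N`, and all heads are on their lists or at the end. -/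
def Valid (N : ℕ) (μ : Mem H) : Prop :=
  ∀ h, μ.pos h ≤ N ∧ (μ.cells h).length = N

variable [DecidableEq H]

def setPos (μ : Mem H) (h : H) (p : ℕ) : Mem H :=
  ⟨Function.update μ.pos h p, μ.cells⟩

def setCells (μ : Mem H) (h : H) (l : List Bool) : Mem H :=
  ⟨μ.pos, Function.update μ.cells h l⟩

/-- Move the head `h` to the right, unless it is at the end. -/
def right (h : H) (μ : Mem H) : Mem H :=
  μ.setPos h (min (μ.pos h + 1) (μ.cells h).length)

def left (h : H) (μ : Mem H) : Mem H :=
  μ.setPos h (μ.pos h - 1)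

theorem Valid.setPos {N : ℕ} {μ : Mem H} (hμ : μ.Valid N) {h : H} {p : ℕ} (hp : p ≤ N) :
    (μ.setPos h p).Valid N := by
  intro h'
  by_cases e : h' = h
  · subst e; simpa [Mem.setPos, hp] using (hμ h').2
  · simpa [Mem.setPos, e] using hμ h'

theorem Valid.setCells {N : ℕ} {μ : Mem H} (hμ : μ.Valid N) {h : H} {l : List Bool}
    (hl : l.length = N) : (μ.setCells h l).Valid N := by
  intro h'
  by_cases e : h' = h
  · subst e; simpa [Mem.setCells, hl] using (hμ h').1
  · simpa [Mem.setCells, e] using hμ h'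

end Mem

/-- A flag together with the contents of the heads. -/
abbrev St (H : Type) := Bool × Mem H

/-- Two stacks for each head, `D` stacks for loop counters, and one for input and output. -/
abbrev Stk (H : Type) (D : ℕ) := Option ((H × Bool) ⊕ Fin D)

/-- The stacks that represent `μ`. -/
def Mem.stacks {H : Type} {D : ℕ} (μ : Mem H) (C : Fin D → List Bool) : Stk H D → List Bool
  | none => []
  | some (.inl (h, false)) => ((μ.cells h).take (μ.pos h)).reverse
  | some (.inl (h, true)) => (μ.cells h).drop (μ.pos h)
  | some (.inr i) => C i

theorem Mem.stacks_clock {H : Type} [DecidableEq H] {D : ℕ} (μ : Mem H) (C : Fin D → List Bool)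
    (i : Fin D) (l : List Bool) :
    μ.stacks (Function.update C i l) = Function.update (μ.stacks C) (some (.inr i)) l := by
  funext k
  rcases k with _ | ⟨⟨h, _ | _⟩⟩ | j
  · simp [Mem.stacks]
  · simp [Mem.stacks]
  · simp [Mem.stacks]
  · by_cases e : j = i
    · subst e; simp [Mem.stacks]
    · simp [Mem.stacks, e]

/-! ### Operations on heads that stack machines carry out in polynomial time. -/

section Realizes

variable {H : Type} [DecidableEq H]

/-- Under the precondition `A`, the operation `g` on states is carried out by a stack machine, in
time polynomial in the number of cells of a head. -/
def Realizes (A : St H → Prop) (g : St H → St H) : Prop :=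
  ∃ (d : ℕ) (T : Polynomial ℕ), ∀ D, d ≤ D → ∃ F : Frag (Stk H D),
    ∀ (N : ℕ) (s : St H) (C : Fin D → List Bool), s.2.Valid N → A s →
      (∀ i : Fin D, i < d → C i = []) →
      (g s).2.Valid N ∧
        F.Run (T.eval N) ((s.1, none), s.2.stacks C) (((g s).1, none), (g s).2.stacks C)

theorem Realizes.congr {A B : St H → Prop} {g g' : St H → St H} (h : Realizes A g)
    (hA : ∀ N s, s.2.Valid N → B s → A s) (hg : ∀ N s, s.2.Valid N → B s → g s = g' s) :
    Realizes B g' := by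
  obtain ⟨d, T, h⟩ := h
  refine ⟨d, T, fun D hD => ?_⟩
  obtain ⟨F, hF⟩ := h D hD
  refine ⟨F, fun N s C hs hB hC => ?_⟩
  rw [← hg N s hs hB]
  exact hF N s C hs (hA N s hs hB) hC

theorem Realizes.of_atom {g : St H → St H}
    (q : ∀ D, TM2.Stmt (fun _ : Stk H D => Bool) Unit Reg)
    (hg : ∀ N s, s.2.Valid N → (g s).2.Valid N)
    (hq : ∀ D N s (C : Fin D → List Bool), s.2.Valid N →
      TM2.stepAux (q D) (s.1, none) (s.2.stacks C) =
        ⟨none, ((g s).1, none), (g s).2.stacks C⟩) :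
    Realizes (fun _ => True) g :=
  ⟨0, 1, fun D _ => ⟨.atom (q D), fun N s C hs _ _ =>
    ⟨hg N s hs, (Frag.run_atom (hq D N s C hs)).mono (by simp)⟩⟩⟩

theorem Realizes.flag (f : Bool → Bool) :
    Realizes (fun _ => True) fun s : St H => (f s.1, s.2) :=
  .of_atom (fun _ => .load (fun v => (f v.1, none)) .halt) (fun _ _ h => h)
    (fun _ _ _ _ _ => rfl)

theorem Realizes.id : Realizes (fun _ => True) fun s : St H => s :=
  .flag fun b => b

theorem Realizes.right (h : H) :
    Realizes (fun _ => True) fun s : St H => (s.1, s.2.right h) := by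
  refine .of_atom (fun D => .pop (some (.inl (h, true))) (fun v o => (v.1, o))
    (.branch (fun v => v.2.isSome) (.push (some (.inl (h, false))) (fun v => v.2.getD false)
      (.load (fun v => (v.1, none)) .halt)) .halt)) ?_ ?_
  · exact fun N s hs => hs.setPos (by rw [(hs h).2]; exact min_le_right _ _)
  · intro D N s C hs
    obtain ⟨b, μ⟩ := s
    have h1 := (hs h).1
    have h2 := (hs h).2
    dsimp only at h1 h2
    rcases h1.lt_or_eq with hlt | heq
    · have hd : (μ.cells h).drop (μ.pos h) =
          (μ.cells h)[μ.pos h] :: (μ.cells h).drop (μ.pos h + 1) :=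
        List.drop_eq_getElem_cons _
      simp only [TM2.stepAux, Mem.stacks, hd, List.head?_cons, Option.isSome_some, cond_true,
        List.tail_cons, Option.getD_some]
      congr 1
      funext k
      rcases k with _ | ⟨⟨h', _ | _⟩⟩ | i
      · simp [Mem.stacks]
      · by_cases e : h' = h
        · subst e
          have : min (μ.pos h' + 1) N = μ.pos h' + 1 := by omega
          have hd' : (μ.cells h').take (μ.pos h' + 1) =
              (μ.cells h').take (μ.pos h') ++ [(μ.cells h')[μ.pos h']] := by
            rw [List.take_add_one, List.getElem?_eq_getElem, Option.toList_some]
          simp only [Mem.stacks, Mem.right, Mem.setPos, Function.update_self, h2, this]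
          rw [hd', List.reverse_append]
          simp [Mem.stacks]
        · simp [Mem.stacks, Mem.right, Mem.setPos, e]
      · by_cases e : h' = h
        · subst e
          have : min (μ.pos h' + 1) N = μ.pos h' + 1 := by omega
          simp [Mem.stacks, Mem.right, Mem.setPos, h2, this]
        · simp [Mem.stacks, Mem.right, Mem.setPos, e]
      · simp [Mem.stacks]
    · have hd : (μ.cells h).drop (μ.pos h) = [] := by simp [h2, heq]
      have hr : μ.right h = μ := by
        have : min (N + 1) N = μ.pos h := by omega
        rw [Mem.right, heq, h2, this, Mem.setPos, Function.update_eq_self]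
      have hu : Function.update (μ.stacks C) (some (.inl (h, true))) [] = μ.stacks C := by
        rw [← hd]; exact Function.update_eq_self _ _
      simp only [TM2.stepAux, hr]
      simp [Mem.stacks, hd]

theorem Realizes.left (h : H) :
    Realizes (fun _ => True) fun s : St H => (s.1, s.2.left h) := by
  refine .of_atom (fun D => .pop (some (.inl (h, false))) (fun v o => (v.1, o))
    (.branch (fun v => v.2.isSome) (.push (some (.inl (h, true))) (fun v => v.2.getD false)
      (.load (fun v => (v.1, none)) .halt)) .halt)) ?_ ?_
  · exact fun N s hs => hs.setPos ((Nat.sub_le _ _).trans (hs h).1)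
  · intro D N s C hs
    obtain ⟨b, μ⟩ := s
    have h1 := (hs h).1
    have h2 := (hs h).2
    dsimp only at h1 h2
    rcases Nat.eq_zero_or_pos (μ.pos h) with heq | hlt
    · have hd : ((μ.cells h).take (μ.pos h)).reverse = [] := by simp [heq]
      have hr : μ.left h = μ := by
        have : 0 - 1 = μ.pos h := by omega
        rw [Mem.left, heq, this, Mem.setPos, Function.update_eq_self]
      have hu : Function.update (μ.stacks C) (some (.inl (h, false))) [] = μ.stacks C := by
        rw [← hd]; exact Function.update_eq_self _ _
      simp only [TM2.stepAux, hr]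
      simp [Mem.stacks, hd]
    · obtain ⟨p, hp⟩ : ∃ p, μ.pos h = p + 1 := ⟨_, (Nat.succ_pred_eq_of_pos hlt).symm⟩
      have hpl : p < (μ.cells h).length := by omega
      have hd : ((μ.cells h).take (μ.pos h)).reverse =
          (μ.cells h)[p] :: ((μ.cells h).take p).reverse := by
        rw [hp, List.take_add_one, List.getElem?_eq_getElem hpl]; simp
      simp only [TM2.stepAux, Mem.stacks, hd, List.head?_cons, Option.isSome_some, cond_true,
        List.tail_cons, Option.getD_some]
      congr 1
      funext k
      rcases k with _ | ⟨⟨h', _ | _⟩⟩ | i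
      · simp [Mem.stacks]
      · by_cases e : h' = h
        · subst e
          simp [Mem.stacks, Mem.left, Mem.setPos, hp]
        · simp [Mem.stacks, Mem.left, Mem.setPos, e]
      · by_cases e : h' = h
        · subst e
          simp [Mem.stacks, Mem.left, Mem.setPos, hp]
        · simp [Mem.stacks, Mem.left, Mem.setPos, e]
      · simp [Mem.stacks]

/-- Set the flag to the symbol under the head `h`. -/
theorem Realizes.read (h : H) :
    Realizes (fun _ => True) fun s : St H => ((s.2.cells h).getD (s.2.pos h) false, s.2) := by
  refine .of_atom (fun D => .peek (some (.inl (h, true))) (fun _ o => (o.getD false, none)) .halt)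
    (fun _ _ h => h) ?_
  intro D N s C hs
  simp [Mem.stacks, List.head?_drop, List.getD_eq_getElem?_getD]

/-- Replace the symbol under the head `h` by the flag. -/
theorem Realizes.write (h : H) :
    Realizes (fun _ => True)
      fun s : St H => (s.1, s.2.setCells h ((s.2.cells h).set (s.2.pos h) s.1)) := by
  refine .of_atom (fun D => .pop (some (.inl (h, true))) (fun v o => (v.1, o))
    (.branch (fun v => v.2.isSome) (.push (some (.inl (h, true))) (fun v => v.1)
      (.load (fun v => (v.1, none)) .halt)) .halt)) ?_ ?_
  · exact fun N s hs => hs.setCells (by rw [List.length_set]; exact (hs h).2)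
  · intro D N s C hs
    obtain ⟨b, μ⟩ := s
    have h1 := (hs h).1
    have h2 := (hs h).2
    dsimp only at h1 h2
    rcases h1.lt_or_eq with hlt | heq
    · have hd : (μ.cells h).drop (μ.pos h) =
          (μ.cells h)[μ.pos h] :: (μ.cells h).drop (μ.pos h + 1) :=
        List.drop_eq_getElem_cons _
      simp only [TM2.stepAux, Mem.stacks, hd, List.head?_cons, Option.isSome_some, cond_true,
        List.tail_cons, Function.update_idem, Function.update_self]
      congr 1
      funext k
      rcases k with _ | ⟨⟨h', _ | _⟩⟩ | i
      · simp [Mem.stacks]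
      · by_cases e : h' = h
        · subst e
          simp [Mem.stacks, Mem.setCells, List.take_set_of_le]
        · simp [Mem.stacks, Mem.setCells, e]
      · by_cases e : h' = h
        · subst e
          simp only [Function.update_self, Mem.stacks, Mem.setCells]
          rw [List.drop_set, if_neg (lt_irrefl _), Nat.sub_self, hd, List.set_cons_zero]
        · simp [Mem.stacks, Mem.setCells, e]
      · simp [Mem.stacks]
    · have hd : (μ.cells h).drop (μ.pos h) = [] := by simp [h2, heq]
      have hr : μ.setCells h ((μ.cells h).set (μ.pos h) b) = μ := by
        rw [List.set_eq_of_length_le (by omega), Mem.setCells, Function.update_eq_self]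
      have hu : Function.update (μ.stacks C) (some (.inl (h, true))) [] = μ.stacks C := by
        rw [← hd]; exact Function.update_eq_self _ _
      simp only [TM2.stepAux, hr]
      simp [Mem.stacks, hd]

/-- Set the flag if the head `h` is at the start. -/
theorem Realizes.atStart (h : H) :
    Realizes (fun _ => True) fun s : St H => (decide (s.2.pos h = 0), s.2) := by
  refine .of_atom (fun D => .peek (some (.inl (h, false))) (fun _ o => (o.isNone, none)) .halt)
    (fun _ _ h => h) ?_
  intro D N s C hs
  obtain ⟨b, μ⟩ := s
  have h1 := (hs h).1
  have h2 := (hs h).2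
  dsimp only at h1 h2
  by_cases hp : μ.pos h = 0
  · simp [Mem.stacks, hp]
  · have : μ.cells h ≠ [] := by
      rintro e; simp [e] at h2; omega
    simp [Mem.stacks, hp, Bool.eq_false_iff, this]

theorem Realizes.seq {A B : St H → Prop} {f g : St H → St H} (hf : Realizes A f)
    (hg : Realizes B g) (hAB : ∀ N s, s.2.Valid N → A s → B (f s)) :
    Realizes A fun s => g (f s) := by
  obtain ⟨d, T, hf⟩ := hf
  obtain ⟨d', T', hg⟩ := hg
  refine ⟨max d d', T + T', fun D hD => ?_⟩
  obtain ⟨F, hF⟩ := hf D ((le_max_left _ _).trans hD)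
  obtain ⟨G, hG⟩ := hg D ((le_max_right _ _).trans hD)
  refine ⟨F.seq G, fun N s C hs hA hC => ?_⟩
  obtain ⟨h1, h2⟩ := hF N s C hs hA fun i hi => hC i (hi.trans_le (le_max_left _ _))
  obtain ⟨h3, h4⟩ := hG N _ C h1 (hAB N s hs hA) fun i hi => hC i (hi.trans_le (le_max_right _ _))
  exact ⟨h3, (Frag.run_seq h2 h4).mono (by simp)⟩

theorem Realizes.ite {A : St H → Prop} {f g : St H → St H}
    (hf : Realizes (fun s => A s ∧ s.1 = true) f) (hg : Realizes (fun s => A s ∧ s.1 = false) g) :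
    Realizes A fun s => if s.1 then f s else g s := by
  obtain ⟨d, T, hf⟩ := hf
  obtain ⟨d', T', hg⟩ := hg
  refine ⟨max d d', T + T' + 1, fun D hD => ?_⟩
  obtain ⟨F, hF⟩ := hf D ((le_max_left _ _).trans hD)
  obtain ⟨G, hG⟩ := hg D ((le_max_right _ _).trans hD)
  refine ⟨F.ite G, fun N s C hs hA hC => ?_⟩
  cases hb : s.1 with
  | true =>
    obtain ⟨h1, h2⟩ := hF N s C hs ⟨hA, hb⟩ fun i hi => hC i (hi.trans_le (le_max_left _ _))
    rw [hb] at h2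
    beta_reduce
    rw [if_pos hb]
    exact ⟨h1, (Frag.run_ite_true h2 rfl).mono (by simp)⟩
  | false =>
    obtain ⟨h1, h2⟩ := hG N s C hs ⟨hA, hb⟩ fun i hi => hC i (hi.trans_le (le_max_right _ _))
    rw [hb] at h2
    beta_reduce
    rw [if_neg (by simp [hb])]
    exact ⟨h1, (Frag.run_ite_false h2 rfl).mono (by simp)⟩

/-- Repeat an operation as often as the position of the head `h` tells at the beginning. -/
theorem Realizes.loop {A : St H → Prop} {g : St H → St H} (hg : Realizes A g)
    (hA : ∀ N s, s.2.Valid N → A s → A (g s)) (h : H) :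
    Realizes A fun s => g^[s.2.pos h] s := by
  obtain ⟨d, T, hg⟩ := hg
  -- The body owns the counters below `d`, and the loop takes counter `d` for itself. At most `N`
  -- passes cost `T + 2` each; moving the stack of the head out and back costs `2 * N + 1` each
  -- time, and the final test one more step.
  refine ⟨d + 1, .X * (T + 2) + (.X * 4 + 3), fun D hD => ?_⟩
  obtain ⟨F, hF⟩ := hg D (by omega)
  let c : Fin D := ⟨d, by omega⟩
  let hL : Stk H D := some (.inl (h, false))
  let cL : Stk H D := some (.inr c)
  -- The pop leaves a symbol in the buffer, whereas the guarantee for `F` is for an empty buffer;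
  -- hence the reset.
  let W : Frag (Stk H D) := .whilePop cL (.seq (.atom (.load (fun v => (v.1, none)) .halt)) F)
  have key : ∀ (N : ℕ) (C : Fin D → List Bool), (∀ i : Fin D, i < d + 1 → C i = []) →
      ∀ (l : List Bool) (s : St H), s.2.Valid N → A s →
      (g^[l.length] s).2.Valid N ∧
        W.Run (l.length * (T.eval N + 2) + 1) ((s.1, none), s.2.stacks (Function.update C c l))
          (((g^[l.length] s).1, none), (g^[l.length] s).2.stacks C) := by
    intro N C hC l
    induction l with
    | nil =>
      intro s hs _
      have : Function.update C c [] = C := by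
        rw [← hC c (by simp [c]), Function.update_eq_self]
      refine ⟨hs, ?_⟩
      rw [this]
      simpa using Frag.run_whilePop_nil (F := .seq (.atom (.load (fun v => (v.1, none)) .halt)) F)
        (k := cL) (v := (s.1, none)) (S := s.2.stacks C) (hC c (by simp [c]))
    | cons b l ih =>
      intro s hs hs'
      obtain ⟨h1, h2⟩ := hF N s (Function.update C c l) hs hs' (fun i hi => by
        have : i ≠ c := by rintro rfl; simp [c] at hi
        simpa [this] using hC i (by omega))
      obtain ⟨h3, h4⟩ := ih (g s) h1 (hA N s hs hs')
      refine ⟨h3, ?_⟩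
      refine (Frag.run_whilePop_cons (l := l) (b := b) ?_
        (Frag.run_seq (Frag.run_atom (b := ((s.1, none), s.2.stacks (Function.update C c l))) ?_) h2)
        h4).mono ?_
      · simp [cL, Mem.stacks]
      · simp [cL, Mem.stacks_clock]
      · simp only [List.length_cons]; ring_nf; omega
  -- The left stack of `h` has as many symbols as its position. It is moved to the free input stack
  -- and back, with a copy to the counter, so the number of passes is fixed before the body may move
  -- `h`.
  refine ⟨.seq (.whilePop hL (.atom (.push none (fun v => v.2.getD false)
    (.load (fun v => (v.1, none)) .halt)))) (.seq (.whilePop none (.atom (.push hL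
      (fun v => v.2.getD false) (.push cL (fun v => v.2.getD false)
        (.load (fun v => (v.1, none)) .halt))))) W), fun N s C hs hs' hC => ?_⟩
  have hp : ((s.2.cells h).take (s.2.pos h)).reverse.length = s.2.pos h := by
    simp [(hs h).2, (hs h).1]
  obtain ⟨h1, h2⟩ := key N C hC ((s.2.cells h).take (s.2.pos h)).reverse s hs hs'
  rw [hp] at h1 h2
  refine ⟨h1, ?_⟩
  have r1 := Frag.run_whilePop_move (k := hL) (k' := none) (by simp [hL])
    ((s.2.cells h).take (s.2.pos h)).reverse (s.1, none) (s.2.stacks C) rfl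
  have r2 := Frag.run_whilePop_copy (k := none) (k' := hL) (k'' := cL) (by simp [hL]) (by simp [cL])
    (by simp [hL, cL]) ((s.2.cells h).take (s.2.pos h)) (s.1, none)
    (Function.update (Function.update (s.2.stacks C) hL []) none
      (((s.2.cells h).take (s.2.pos h)).reverse.reverse ++ s.2.stacks C none))
    (by simp [Mem.stacks])
  have e : Function.update (Function.update (Function.update (Function.update (Function.update
      (s.2.stacks C) hL []) none
      (((s.2.cells h).take (s.2.pos h)).reverse.reverse ++ s.2.stacks C none)) none []) hL
      (((s.2.cells h).take (s.2.pos h)).reverse ++ Function.update (Function.update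
      (s.2.stacks C) hL []) none
      (((s.2.cells h).take (s.2.pos h)).reverse.reverse ++ s.2.stacks C none) hL)) cL
      (((s.2.cells h).take (s.2.pos h)).reverse ++ Function.update (Function.update
      (s.2.stacks C) hL []) none
      (((s.2.cells h).take (s.2.pos h)).reverse.reverse ++ s.2.stacks C none) cL) =
      s.2.stacks (Function.update C c ((s.2.cells h).take (s.2.pos h)).reverse) := by
    have h0 : C c = [] := hC c (by simp [c])
    rw [Mem.stacks_clock]
    funext k
    rcases k with _ | ⟨⟨h', _ | _⟩⟩ | i
    · simp [Mem.stacks, hL, cL]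
    · by_cases e : h' = h
      · subst e; simp [Mem.stacks, hL, cL]
      · simp [Mem.stacks, hL, cL, e]
    · simp [Mem.stacks, hL, cL]
    · by_cases e : i = c
      · subst e; simp [Mem.stacks, hL, cL, h0]
      · simp [Mem.stacks, hL, cL, e]
  rw [e] at r2
  refine (Frag.run_seq r1 (Frag.run_seq r2 h2)).mono ?_
  rw [hp, ← List.length_reverse, hp]
  have := Nat.mul_le_mul_right (T.eval N + 2) (hs h).1
  have := (hs h).1
  simp
  omega

end Realizes

/-! ### Decidable properties of words and tuples of numbers -/

open Turing

section Iterate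

variable {H : Type} [DecidableEq H]

theorem Mem.setPos_self (μ : Mem H) (h : H) : μ.setPos h (μ.pos h) = μ := by
  simp [Mem.setPos]

theorem Mem.setPos_eq_self {μ : Mem H} {h : H} {p : ℕ} (hp : μ.pos h = p) : μ.setPos h p = μ := by
  rw [← hp, Mem.setPos_self]

@[simp]
theorem Mem.setPos_setPos (μ : Mem H) (h : H) (p q : ℕ) :
    (μ.setPos h p).setPos h q = μ.setPos h q := by
  simp [Mem.setPos]

@[simp]
theorem Mem.setPos_pos_self (μ : Mem H) (h : H) (p : ℕ) : (μ.setPos h p).pos h = p := by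
  simp [Mem.setPos]

theorem Mem.setPos_pos_of_ne (μ : Mem H) {h h' : H} (p : ℕ) (e : h' ≠ h) :
    (μ.setPos h p).pos h' = μ.pos h' := by
  simp [Mem.setPos, e]

@[simp]
theorem Mem.setPos_cells (μ : Mem H) (h : H) (p : ℕ) : (μ.setPos h p).cells = μ.cells := rfl

@[simp]
theorem Mem.setCells_pos (μ : Mem H) (h : H) (l : List Bool) : (μ.setCells h l).pos = μ.pos := rfl

@[simp]
theorem Mem.setCells_cells_self (μ : Mem H) (h : H) (l : List Bool) :
    (μ.setCells h l).cells h = l := by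
  simp [Mem.setCells]

@[simp]
theorem Mem.setCells_setCells (μ : Mem H) (h : H) (l l' : List Bool) :
    (μ.setCells h l).setCells h l' = μ.setCells h l' := by
  simp [Mem.setCells]

theorem Mem.setCells_self (μ : Mem H) (h : H) : μ.setCells h (μ.cells h) = μ := by
  simp [Mem.setCells]

theorem Mem.setPos_setCells (μ : Mem H) (h h' : H) (p : ℕ) (l : List Bool) :
    (μ.setPos h p).setCells h' l = (μ.setCells h' l).setPos h p := rfl

theorem iterate_right (h : H) (k : ℕ) (s : St H) (hs : s.2.pos h ≤ (s.2.cells h).length) :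
    (fun s : St H => (s.1, s.2.right h))^[k] s =
      (s.1, s.2.setPos h (min (s.2.pos h + k) (s.2.cells h).length)) := by
  induction k with
  | zero => simp [hs, Mem.setPos_self]
  | succ k ih =>
    rw [Function.iterate_succ_apply', ih, Mem.right]
    simp only [Mem.setPos_pos_self, Mem.setPos_setPos, Mem.setPos_cells]
    congr 2
    omega

theorem iterate_left (h : H) (k : ℕ) (s : St H) :
    (fun s : St H => (s.1, s.2.left h))^[k] s = (s.1, s.2.setPos h (s.2.pos h - k)) := by
  induction k with
  | zero => simp [Mem.setPos_self]
  | succ k ih =>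
    rw [Function.iterate_succ_apply', ih, Mem.left]
    simp only [Mem.setPos_pos_self, Mem.setPos_setPos]
    congr 2

theorem Realizes.home (h : H) :
    Realizes (fun _ => True) fun s : St H => (s.1, s.2.setPos h 0) := by
  refine ((Realizes.left h).loop (fun _ _ _ _ => trivial) h).congr (fun _ _ _ _ => trivial) ?_
  intro N s _ _
  simp [iterate_left]

theorem Realizes.valid {A : St H → Prop} {g : St H → St H} (hg : Realizes A g) {N : ℕ} {s : St H}
    (hs : s.2.Valid N) (h : A s) : (g s).2.Valid N := by
  obtain ⟨d, T, hg⟩ := hg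
  obtain ⟨F, hF⟩ := hg d le_rfl
  exact (hF N s (fun _ => []) hs h fun _ _ => rfl).1

theorem Realizes.weaken {g : St H → St H} (hg : Realizes (fun _ => True) g) {A : St H → Prop} :
    Realizes A g :=
  hg.congr (fun _ _ _ _ => trivial) fun _ _ _ _ => rfl

end Iterate

/-- The heads of our programs: one at the end of the input, one to read the input, one for
auxiliary counting, one with a list of bits to write on, and twelve numerical variables. -/
inductive Head
  | eof | input | scratch | array | var (i : Fin 12)
  deriving DecidableEq, Fintype

namespace Mem

def word (μ : Mem Head) : List Bool := μ.cells .input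

/-- The values of the numerical variables. -/
def env (μ : Mem Head) (i : ℕ) : ℕ := if h : i < 12 then μ.pos (.var ⟨i, h⟩) else 0

/-- The state between two operations of a program that uses the variables below `d`. -/
structure Inv (d : ℕ) (μ : Mem Head) : Prop where
  eof : μ.pos .eof = μ.word.length
  input : μ.pos .input = 0
  scratch : μ.pos .scratch = 0
  array : μ.pos .array = 0
  vars : ∀ i, d ≤ i → μ.env i = 0

@[simp] theorem word_setPos (μ : Mem Head) (h : Head) (p : ℕ) : (μ.setPos h p).word = μ.word := rfl

@[simp] theorem word_setCells (μ : Mem Head) (l : List Bool) :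
    (μ.setCells .array l).word = μ.word := by
  simp [word, setCells]

@[simp] theorem env_setCells (μ : Mem Head) (h : Head) (l : List Bool) :
    (μ.setCells h l).env = μ.env := rfl

theorem env_setPos_var (μ : Mem Head) {i : ℕ} (hi : i < 12) (p : ℕ) :
    (μ.setPos (.var ⟨i, hi⟩) p).env = Function.update μ.env i p := by
  funext j
  by_cases e : j = i
  · subst e; simp [env, setPos, hi]
  · simp [env, setPos, e]

@[simp] theorem env_setPos_input (μ : Mem Head) (p : ℕ) : (μ.setPos .input p).env = μ.env := by
  funext j; simp [env, setPos]

@[simp] theorem env_setPos_scratch (μ : Mem Head) (p : ℕ) :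
    (μ.setPos .scratch p).env = μ.env := by
  funext j; simp [env, setPos]

@[simp] theorem env_setPos_array (μ : Mem Head) (p : ℕ) : (μ.setPos .array p).env = μ.env := by
  funext j; simp [env, setPos]

theorem env_eq {μ : Mem Head} {i : ℕ} (hi : i < 12) : μ.env i = μ.pos (.var ⟨i, hi⟩) := by
  simp [env, hi]

theorem Inv.mono {d d' : ℕ} {μ : Mem Head} (h : μ.Inv d) (hd : d ≤ d') : μ.Inv d' :=
  { h with vars := fun i hi => h.vars i (hd.trans hi) }

theorem Inv.setPos_var {d : ℕ} {μ : Mem Head} (h : μ.Inv d) {i : ℕ} (hi : i < 12) (hd : i < d)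
    (p : ℕ) : (μ.setPos (.var ⟨i, hi⟩) p).Inv d where
  eof := by simpa [setPos, word] using h.eof
  input := by simpa [setPos] using h.input
  scratch := by simpa [setPos] using h.scratch
  array := by simpa [setPos] using h.array
  vars := fun j hj => by
    have : j ≠ i := by omega
    simpa [env_setPos_var, this] using h.vars j hj

theorem Inv.setCells {d : ℕ} {μ : Mem Head} (h : μ.Inv d) (l : List Bool) :
    (μ.setCells .array l).Inv d :=
  { eof := by simpa using h.eof
    input := h.input
    scratch := h.scratch
    array := h.array
    vars := h.vars }

end Mem

/-- Arithmetic terms over the length of the input and the numerical variables. -/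
inductive NumTerm
  | const (k : ℕ)
  | len
  | var (i : ℕ)
  | add (t u : NumTerm)
  | mul (i : ℕ) (t : NumTerm)

namespace NumTerm

def eval (N : ℕ) (ρ : ℕ → ℕ) : NumTerm → ℕ
  | const k => k
  | len => N
  | var i => ρ i
  | add t u => t.eval N ρ + u.eval N ρ
  | mul i t => ρ i * t.eval N ρ

/-- The value of a term in a state. -/
def value (t : NumTerm) (μ : Mem Head) : ℕ := t.eval (μ.pos .eof) μ.env

end NumTerm

/-- Repeat an operation that leaves the numerical variables unchanged. -/
theorem Realizes.rep {A : St Head → Prop} {g : St Head → St Head} (hg : Realizes A g)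
    (hA : ∀ N s, s.2.Valid N → A s → A (g s))
    (hv : ∀ N s, s.2.Valid N → A s → ∀ t : NumTerm, t.value (g s).2 = t.value s.2) (t : NumTerm) :
    Realizes A fun s => g^[t.value s.2] s := by
  have it : ∀ N s k, s.2.Valid N → A s → (g^[k] s).2.Valid N ∧ A (g^[k] s) ∧
      ∀ t : NumTerm, t.value (g^[k] s).2 = t.value s.2 := by
    intro N s k hs h
    induction k with
    | zero => exact ⟨hs, h, fun _ => rfl⟩
    | succ k ih =>
      obtain ⟨h1, h2, h3⟩ := ih
      rw [Function.iterate_succ_apply']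
      exact ⟨hg.valid h1 h2, hA N _ h1 h2, fun t => (hv N _ h1 h2 t).trans (h3 t)⟩
  induction t with
  | const k =>
    simp only [NumTerm.value, NumTerm.eval]
    induction k with
    | zero => exact Realizes.id.weaken
    | succ k ih =>
      simp only [Function.iterate_succ_apply']
      exact ih.seq hg fun N s hs h => (it N s k hs h).2.1
  | len => exact hg.loop hA .eof
  | var i =>
    by_cases hi : i < 12
    · simpa only [NumTerm.value, NumTerm.eval, Mem.env_eq hi] using hg.loop hA (.var ⟨i, hi⟩)
    · simp only [NumTerm.value, NumTerm.eval, Mem.env, hi, dite_false]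
      exact Realizes.id.weaken
  | add t u ht hu =>
    -- `t` is evaluated only after the repetitions for `u`; by `hv` its value is still the same.
    refine (hu.seq ht fun N s hs h => (it N s _ hs h).2.1).congr (fun _ _ _ h => h) ?_
    intro N s hs h
    rw [(it N s _ hs h).2.2 t, ← Function.iterate_add_apply]
    rfl
  | mul i t ht =>
    by_cases hi : i < 12
    -- A product is a nested loop; the inner count is evaluated anew in each outer pass, again
    -- without change.
    · refine (ht.loop (fun N s hs h => (it N s _ hs h).2.1) (.var ⟨i, hi⟩)).congr
        (fun _ _ _ h => h) ?_
      intro N s hs h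
      have : ∀ k, (fun s => g^[t.value s.2] s)^[k] s = g^[k * t.value s.2] s := by
        intro k
        induction k with
        | zero => simp
        | succ k ih =>
          rw [Function.iterate_succ_apply', ih]
          rw [(it N s _ hs h).2.2 t, ← Function.iterate_add_apply, Nat.succ_mul, Nat.add_comm]
      rw [this]
      simp only [NumTerm.value, NumTerm.eval, Mem.env_eq hi]
    · simp only [NumTerm.value, NumTerm.eval, Mem.env, hi, dite_false, Nat.zero_mul]
      exact Realizes.id.weaken

theorem NumTerm.value_setPos {μ : Mem Head} {h : Head}
    (hh : h = .input ∨ h = .scratch ∨ h = .array) (t : NumTerm) (p : ℕ) :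
    t.value (μ.setPos h p) = t.value μ := by
  rcases hh with rfl | rfl | rfl <;> simp [NumTerm.value, Mem.setPos_pos_of_ne]

/-- Move a head to the right by the value of a term. -/
theorem Realizes.advance {h : Head} (hh : h = .input ∨ h = .scratch ∨ h = .array) (t : NumTerm) :
    Realizes (fun _ => True) fun s =>
      (s.1, s.2.setPos h (min (s.2.pos h + t.value s.2) (s.2.cells h).length)) := by
  refine ((Realizes.right h).rep (fun _ _ _ _ => trivial)
    (fun _ _ _ _ t => t.value_setPos hh _) t).congr (fun _ _ _ _ => trivial) ?_
  intro N s hs _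
  rw [iterate_right _ _ _ ((hs h).2 ▸ (hs h).1)]

/-- Move a head to the left by the value of a term. -/
theorem Realizes.retreat {h : Head} (hh : h = .input ∨ h = .scratch ∨ h = .array) (t : NumTerm) :
    Realizes (fun _ => True) fun s => (s.1, s.2.setPos h (s.2.pos h - t.value s.2)) := by
  refine ((Realizes.left h).rep (fun _ _ _ _ => trivial)
    (fun _ _ _ _ t => t.value_setPos hh _) t).congr (fun _ _ _ _ => trivial) ?_
  intro N s hs _
  rw [iterate_left]

open scoped Classical in
/-- A program that uses only the variables from `d` on, and the list of bits if it satisfies `Q`,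
decides whether the input word and the values of the variables satisfy `P`. -/
def Decides (Q : List Bool → Prop) (d : ℕ) (P : List Bool → (ℕ → ℕ) → Prop) : Prop :=
  Realizes (fun s => s.2.Inv d ∧ Q (s.2.cells .array))
    fun s => (decide (P s.2.word s.2.env), s.2)

/-! ### Closure of decidable properties under connectives and bounded quantifiers. -/

namespace Decides

variable {Q : List Bool → Prop} {d : ℕ} {P P' : List Bool → (ℕ → ℕ) → Prop}

theorem congr (h : Decides Q d P) (hP : ∀ x ρ, P x ρ ↔ P' x ρ) : Decides Q d P' := by
  have : P = P' := by funext x ρ; exact propext (hP x ρ)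
  exact this ▸ h

theorem mono (h : Decides Q d P) {Q' : List Bool → Prop} {d' : ℕ} (hQ : ∀ a, Q' a → Q a)
    (hd : d' ≤ d) : Decides Q' d' P :=
  Realizes.congr h (fun _ _ _ h => ⟨h.1.mono hd, hQ _ h.2⟩) fun _ _ _ _ => rfl

theorem not (h : Decides Q d P) : Decides Q d fun x ρ => ¬ P x ρ := by
  refine (Realizes.seq h (Realizes.flag Bool.not) fun _ _ _ _ => trivial).congr
    (fun _ _ _ h => h) ?_
  intro N s _ _
  simp

theorem and (h : Decides Q d P) (h' : Decides Q d P') :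
    Decides Q d fun x ρ => P x ρ ∧ P' x ρ := by
  refine (Realizes.seq h (Realizes.ite (A := fun s => s.2.Inv d ∧ Q (s.2.cells .array))
    (Realizes.congr h' (fun _ _ _ h => h.1) fun _ _ _ _ => rfl)
    Realizes.id.weaken) fun _ _ _ h => h).congr (fun _ _ _ h => h) ?_
  intro N s _ _
  by_cases e : P s.2.word s.2.env <;> simp [e]

theorem or (h : Decides Q d P) (h' : Decides Q d P') :
    Decides Q d fun x ρ => P x ρ ∨ P' x ρ :=
  (h.not.and h'.not).not.congr fun x ρ => by tauto

theorem imp (h : Decides Q d P) (h' : Decides Q d P') :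
    Decides Q d fun x ρ => P x ρ → P' x ρ :=
  (h.and h'.not).not.congr fun x ρ => by tauto

/-- Comparison of the values of terms. -/
theorem le (t u : NumTerm) :
    Decides Q d fun x ρ => min (t.eval x.length ρ) x.length ≤ u.eval x.length ρ := by
  have hh : Head.scratch = .input ∨ Head.scratch = .scratch ∨ Head.scratch = .array := by simp
  -- The scratch head goes right by `t`, but not past the end, and then left by `u`. It is back at
  -- the start iff `min t N ≤ u`, which explains the truncation in the statement.
  refine ((((Realizes.advance hh t).seq (Realizes.retreat hh u) fun _ _ _ _ => trivial).seq
    (Realizes.atStart .scratch) fun _ _ _ _ => trivial).seq (Realizes.home .scratch)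
      fun _ _ _ _ => trivial).congr (fun _ _ _ _ => trivial) ?_
  intro N s hs h
  have hl : (s.2.cells .scratch).length = s.2.word.length :=
    (hs .scratch).2.trans (hs .input).2.symm
  have e : s.2.setPos .scratch 0 = s.2 := Mem.setPos_eq_self h.1.scratch
  simp only [Mem.setPos_setPos, Mem.setPos_pos_self, NumTerm.value_setPos hh, e, h.1.scratch, hl]
  simp only [NumTerm.value, h.1.eof, Nat.zero_add, Prod.mk.injEq, and_true, decide_eq_decide]
  omega

/-- Reading the input word. -/
theorem bit (t : NumTerm) :
    Decides Q d fun x ρ => x.getD (t.eval x.length ρ) false = true := by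
  have hh : Head.input = .input ∨ Head.input = .scratch ∨ Head.input = .array := by simp
  refine (((Realizes.advance hh t).seq (Realizes.read .input) fun _ _ _ _ => trivial).seq
    (Realizes.home .input) fun _ _ _ _ => trivial).congr (fun _ _ _ _ => trivial) ?_
  intro N s hs h
  have e : s.2.setPos .input 0 = s.2 := Mem.setPos_eq_self h.1.input
  have e' : s.2.cells .input = s.2.word := rfl
  simp only [Mem.setPos_setPos, Mem.setPos_pos_self, Mem.setPos_cells, NumTerm.value, e, e',
    h.1.input, h.1.eof, Nat.zero_add, Prod.mk.injEq, and_true, Bool.decide_eq_true]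
  -- A head stopped at the end reads the default `false`, as `getD` does at every position out of
  -- range.
  rcases le_total (t.eval s.2.word.length s.2.env) s.2.word.length with hl | hl
  · rw [min_eq_left hl]
  · rw [min_eq_right hl, List.getD_eq_default _ _ le_rfl, List.getD_eq_default _ _ hl]

-- The variable `d` starts at `0` and moves right once per pass, while the flag collects the
-- disjunction of the tests. Sending the variable home restores the state, so quantifiers can be
-- nested.
open scoped Classical in
theorem exists_lt_pos (hd : d < 12) (h : Decides Q (d + 1) P) (b : Head) :
    Realizes (fun s => s.2.Inv d ∧ Q (s.2.cells .array)) fun s =>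
      (decide (∃ k < s.2.pos b, P s.2.word (Function.update s.2.env d k)), s.2) := by
  let v : Head := .var ⟨d, hd⟩
  let A : St Head → Prop := fun s => s.2.Inv (d + 1) ∧ Q (s.2.cells .array)
  have body : Realizes A fun s => (s.1 || decide (P s.2.word s.2.env), s.2.right v) := by
    refine ((Realizes.ite (A := A) (Realizes.id (H := Head)).weaken
      (Realizes.congr h (fun _ _ _ h => h.1) fun _ _ _ _ => rfl)).seq
        (Realizes.right v) fun _ _ _ _ => trivial).congr (fun _ _ _ h => h) ?_
    rintro N ⟨_ | _, μ⟩ _ _ <;> simp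
  have hA : ∀ N s, s.2.Valid N → A s →
      A (s.1 || decide (P s.2.word s.2.env), s.2.right v) :=
    fun N s _ h => ⟨h.1.setPos_var hd (Nat.lt_succ_self d) _, h.2⟩
  refine ((((Realizes.flag fun _ => false).weaken (A := A)).seq (body.loop hA b)
    fun _ _ _ h => h).seq (Realizes.home v) fun _ _ _ _ => trivial).congr
      (fun _ _ _ h => ⟨h.1.mono (Nat.le_succ d), h.2⟩) ?_
  intro N s hs h
  have hv : s.2.setPos v 0 = s.2 := by
    have : s.2.pos v = 0 := by
      rw [← h.1.vars d le_rfl, Mem.env_eq hd]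
    rw [← this, Mem.setPos_self]
  -- As long as `k ≤ N`, the variable is never stopped by the end of its cells and really takes the
  -- value `k`.
  have key : ∀ k ≤ N, (fun s : St Head => (s.1 || decide (P s.2.word s.2.env), s.2.right v))^[k]
      (false, s.2) =
      (decide (∃ k' < k, P s.2.word (Function.update s.2.env d k')), s.2.setPos v k) := by
    intro k hk
    induction k with
    | zero => simp [hv]
    | succ k ih =>
      rw [Function.iterate_succ_apply', ih (by omega)]
      have e : min (k + 1) N = k + 1 := by omega
      simp only [Mem.word_setPos, Mem.right, Mem.setPos_pos_self, Mem.setPos_setPos,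
        Mem.setPos_cells, (hs v).2, e, v, Mem.env_setPos_var, Prod.mk.injEq, and_true]
      rw [← Bool.decide_or, decide_eq_decide]
      simp only [Nat.lt_succ_iff_lt_or_eq, or_and_right, exists_or, exists_eq_left]
  rw [key _ (hs b).1, Mem.setPos_setPos, hv]

theorem exists_lt_len (hd : d < 12) (h : Decides Q (d + 1) P) :
    Decides Q d fun x ρ => ∃ k < x.length, P x (Function.update ρ d k) :=
  Realizes.congr (exists_lt_pos hd h .eof) (fun _ _ _ h => h) fun N s _ h => by
    rw [Prod.mk.injEq, decide_eq_decide, h.1.eof]; exact ⟨Iff.rfl, rfl⟩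

theorem exists_lt_var (hd : d < 12) (h : Decides Q (d + 1) P) {i : ℕ} (hi : i < 12) :
    Decides Q d fun x ρ => ∃ k < ρ i, P x (Function.update ρ d k) :=
  Realizes.congr (exists_lt_pos hd h (.var ⟨i, hi⟩)) (fun _ _ _ h => h) fun N s _ _ => by
    rw [Prod.mk.injEq, decide_eq_decide, ← Mem.env_eq hi]; exact ⟨Iff.rfl, rfl⟩

theorem forall_lt_var (hd : d < 12) (h : Decides Q (d + 1) P) {i : ℕ} (hi : i < 12) :
    Decides Q d fun x ρ => ∀ k < ρ i, P x (Function.update ρ d k) :=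
  (exists_lt_var hd h.not hi).not.congr fun x ρ => by simp

end Decides

/-! ### Reachability -/

open Turing

/-! ### Graph search by repeated relaxation of a list of bits. -/

section Search

open Relation

open scoped Classical in
/-- Set all bits with a position that satisfies `R`. -/
noncomputable def markAll (a : List Bool) (R : ℕ → Prop) : List Bool :=
  a.mapIdx fun v b => b || decide (R v)

@[simp]
theorem length_markAll (a : List Bool) (R : ℕ → Prop) : (markAll a R).length = a.length := by
  simp [markAll]

theorem getD_markAll (a : List Bool) (R : ℕ → Prop) (v : ℕ) :
    (markAll a R).getD v false = true ↔ a.getD v false = true ∨ (v < a.length ∧ R v) := by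
  by_cases h : v < a.length
  · simp [markAll, h]
  · simp [markAll, h]

theorem markAll_of_forall_not (a : List Bool) {R : ℕ → Prop} (h : ∀ v, ¬ R v) :
    markAll a R = a := by
  apply List.ext_getElem <;> simp [markAll, h]

theorem set_markAll (a : List Bool) (R : ℕ → Prop) (k : ℕ) (hk : R k) :
    (markAll a fun v => v < k ∧ R v).set k true = markAll a fun v => v < k + 1 ∧ R v := by
  apply List.ext_getElem
  · simp
  · intro v h1 h2
    by_cases e : v = k
    · subst e; simp [markAll, hk]
    · have : v < k + 1 ↔ v < k := by omega
      simp only [markAll, List.getElem_set_ne (Ne.symm e), List.getElem_mapIdx]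
      congr 1
      exact decide_eq_decide.2 (by rw [this])

theorem markAll_succ (a : List Bool) (R : ℕ → Prop) (k : ℕ) (hk : ¬ R k) :
    (markAll a fun v => v < k + 1 ∧ R v) = markAll a fun v => v < k ∧ R v := by
  congr
  funext v
  by_cases e : v = k
  · subst e; simp [hk]
  · have : v < k + 1 ↔ v < k := by omega
    rw [this]

theorem markAll_lt (a : List Bool) (R : ℕ → Prop) (k : ℕ) (hk : a.length ≤ k) :
    (markAll a fun v => v < k ∧ R v) = markAll a R := by
  apply List.ext_getElem
  · simp
  · intro v h1 h2
    simp only [length_markAll] at h1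
    simp only [markAll, List.getElem_mapIdx]
    congr 1
    exact decide_eq_decide.2 (by simp [h1.trans_le hk])

open scoped Classical in
/-- One round of search: go through the positions below `k`, and from each position with its bit
set, set the bits of all successors. -/
noncomputable def relax (R : ℕ → ℕ → Prop) (a : List Bool) : ℕ → List Bool
  | 0 => a
  | k + 1 => if (relax R a k).getD k false = true then markAll (relax R a k) (R k) else relax R a k

@[simp]
theorem length_relax (R : ℕ → ℕ → Prop) (a : List Bool) (k : ℕ) :
    (relax R a k).length = a.length := by
  induction k with
  | zero => rfl
  | succ k ih => rw [relax]; split_ifs <;> simp [ih]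

theorem getD_relax_succ (R : ℕ → ℕ → Prop) (a : List Bool) (k v : ℕ) :
    (relax R a (k + 1)).getD v false = true ↔ (relax R a k).getD v false = true ∨
      ((relax R a k).getD k false = true ∧ v < a.length ∧ R k v) := by
  rw [relax]
  split_ifs with h
  · rw [getD_markAll, length_relax]; tauto
  · tauto

theorem subset_relax (R : ℕ → ℕ → Prop) (a : List Bool) (k v : ℕ) (h : a.getD v false = true) :
    (relax R a k).getD v false = true := by
  induction k with
  | zero => exact h
  | succ k ih => exact (getD_relax_succ R a k v).2 (.inl ih)

theorem successors_relax (R : ℕ → ℕ → Prop) (a : List Bool) (k u v : ℕ) (hu : u < k)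
    (h : a.getD u false = true) (hv : v < a.length) (huv : R u v) :
    (relax R a k).getD v false = true := by
  induction k with
  | zero => omega
  | succ k ih =>
    rw [getD_relax_succ]
    rcases Nat.lt_succ_iff_lt_or_eq.1 hu with hu | rfl
    · exact .inl (ih hu)
    · exact .inr ⟨subset_relax R a u u h, hv, huv⟩

theorem lt_length_of_getD {a : List Bool} {v : ℕ} (h : a.getD v false = true) : v < a.length := by
  by_contra hv
  rw [List.getD_eq_default _ _ (by omega)] at h
  simp at h

/-- Bits set earlier in a round are already used later in the same round, so soundness is stated for
any property `p` closed under `R`, not for paths of bounded length. -/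
theorem relax_sound (R : ℕ → ℕ → Prop) (a : List Bool) (p : ℕ → Prop)
    (hp : ∀ u v, p u → u < a.length → v < a.length → R u v → p v)
    (ha : ∀ v, a.getD v false = true → p v) (k v : ℕ) (h : (relax R a k).getD v false = true) :
    p v := by
  induction k generalizing v with
  | zero => exact ha v h
  | succ k ih =>
    rcases (getD_relax_succ R a k v).1 h with h | ⟨h, hv, hR⟩
    · exact ih v h
    · exact hp k v (ih k h) (by simpa using lt_length_of_getD h) hv hR

/-- `N` rounds suffice: the marked sets increase, and the first one contains `src`. If each of the
`N` rounds added a position, more than `N` positions would be marked. So some round adds nothing,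
and its set is closed under `R`. If `src` is out of range, `set` marks nothing, which agrees with
the right-hand side. -/
theorem getD_iterate_relax (R : ℕ → ℕ → Prop) (N src tgt : ℕ) :
    ((fun a => relax R a N)^[N] ((List.replicate N false).set src true)).getD tgt false = true ↔
      src < N ∧ tgt < N ∧ ReflTransGen (fun u v => u < N ∧ v < N ∧ R u v) src tgt := by
  set f : List Bool → List Bool := fun a => relax R a N
  set a₀ := (List.replicate N false).set src true with ha₀
  have len : ∀ r, (f^[r] a₀).length = N := by
    intro r
    induction r with
    | zero => simp [ha₀]
    | succ r ih => rw [Function.iterate_succ_apply']; simpa [f] using ih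
  have init : ∀ v, a₀.getD v false = true ↔ src < N ∧ v = src := by
    intro v
    by_cases hv : v < N
    · by_cases e : v = src
      · subst e; simp [ha₀, hv]
      · simp [ha₀, hv, e, List.getElem_set_ne (Ne.symm e)]
    · have : ¬ (src < N ∧ v = src) := by omega
      simp [ha₀, hv, this]
  constructor
  · intro h
    have sound : ∀ r v, (f^[r] a₀).getD v false = true →
        src < N ∧ ReflTransGen (fun u v => u < N ∧ v < N ∧ R u v) src v := by
      intro r
      induction r with
      | zero =>
        intro v h
        obtain ⟨h1, rfl⟩ := (init v).1 h
        exact ⟨h1, .refl⟩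
      | succ r ih =>
        intro v h
        rw [Function.iterate_succ_apply'] at h
        refine relax_sound R (f^[r] a₀) _ ?_ ih N v h
        rintro u v ⟨h1, h2⟩ hu hv hR
        rw [len] at hu hv
        exact ⟨h1, h2.tail ⟨hu, hv, hR⟩⟩
    obtain ⟨h1, h2⟩ := sound N tgt h
    exact ⟨h1, (lt_length_of_getD h).trans_eq (len N), h2⟩
  · rintro ⟨h1, h2, h3⟩
    classical
    let T : ℕ → Finset ℕ := fun r => (Finset.range N).filter fun v => (f^[r] a₀).getD v false = true
    have memT : ∀ r v, v ∈ T r ↔ (f^[r] a₀).getD v false = true := by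
      intro r v
      simp only [T, Finset.mem_filter, Finset.mem_range, and_iff_right_iff_imp]
      exact fun h => (lt_length_of_getD h).trans_eq (len r)
    have mono : ∀ r, T r ⊆ T (r + 1) := by
      intro r v hv
      rw [memT] at hv ⊢
      rw [Function.iterate_succ_apply']
      exact subset_relax R _ N v hv
    have monot : Monotone T := monotone_nat_of_le_succ mono
    obtain ⟨r, hr, hT⟩ : ∃ r < N, T r = T (r + 1) := by
      by_contra hne
      push Not at hne
      have card : ∀ r ≤ N, r + 1 ≤ (T r).card := by
        intro r
        induction r with
        | zero =>
          intro _
          have : src ∈ T 0 := (memT 0 src).2 ((init src).2 ⟨h1, rfl⟩)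
          exact Finset.card_pos.2 ⟨_, this⟩
        | succ r ih =>
          intro hr
          have := Finset.card_lt_card ((mono r).ssubset_of_ne (hne r (by omega)))
          have := ih (by omega)
          omega
      have h4 := card N le_rfl
      have h5 : (T N).card ≤ N :=
        (Finset.card_filter_le _ _).trans_eq (Finset.card_range N)
      omega
    have closed : ∀ v, ReflTransGen (fun u v => u < N ∧ v < N ∧ R u v) src v → v ∈ T r := by
      intro v hv
      induction hv with
      | refl => exact monot (Nat.zero_le r) ((memT 0 src).2 ((init src).2 ⟨h1, rfl⟩))
      | @tail u v _ huv ih =>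
        rw [hT, memT, Function.iterate_succ_apply']
        exact successors_relax R _ N u v huv.1 ((memT r u).1 ih) (by rw [len]; exact huv.2.1) huv.2.2
    exact (memT N tgt).1 (monot hr.le (closed tgt h3))

end Search

/-! ### Machine operations on the list of bits. -/

namespace Realizes

/-- Set the bit at the position given by a term. -/
theorem markAt (d : ℕ) (t : NumTerm) :
    Realizes (fun s => s.2.Inv d) fun s =>
      (true, s.2.setCells .array ((s.2.cells .array).set (t.value s.2) true)) := by
  have hh : Head.array = .input ∨ Head.array = .scratch ∨ Head.array = .array := by simp
  refine ((((Realizes.advance hh t).seq (Realizes.flag fun _ => true) fun _ _ _ _ => trivial).seq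
    (Realizes.write .array) fun _ _ _ _ => trivial).seq
    (Realizes.home .array) fun _ _ _ _ => trivial).congr (fun _ _ _ _ => trivial) ?_
  intro N s hs h
  -- A head stopped at the end writes nothing, just as `List.set` does out of range.
  have e : (s.2.cells .array).set (min (t.value s.2) N) true =
      (s.2.cells .array).set (t.value s.2) true := by
    rcases le_total (t.value s.2) N with hl | hl
    · rw [min_eq_left hl]
    · rw [min_eq_right hl, List.set_eq_of_length_le (hs .array).2.le,
        List.set_eq_of_length_le ((hs .array).2.trans_le hl)]
  simp only [Mem.setPos_pos_self, Mem.setPos_cells, Mem.setPos_setCells, Mem.setPos_setPos,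
    h.array, (hs .array).2, Nat.zero_add, e]
  exact congrArg (Prod.mk true) (Mem.setPos_eq_self h.array)

/-- Read the bit at the position given by a term. -/
theorem testAt (d : ℕ) (t : NumTerm) :
    Realizes (fun s => s.2.Inv d) fun s => ((s.2.cells .array).getD (t.value s.2) false, s.2) := by
  have hh : Head.array = .input ∨ Head.array = .scratch ∨ Head.array = .array := by simp
  refine (((Realizes.advance hh t).seq (Realizes.read .array) fun _ _ _ _ => trivial).seq
    (Realizes.home .array) fun _ _ _ _ => trivial).congr (fun _ _ _ _ => trivial) ?_
  intro N s hs h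
  have e : s.2.setPos .array 0 = s.2 := Mem.setPos_eq_self h.array
  simp only [Mem.setPos_setPos, Mem.setPos_pos_self, Mem.setPos_cells, e, h.array, Nat.zero_add]
  rcases le_total (t.value s.2) (s.2.cells .array).length with hl | hl
  · rw [min_eq_left hl]
  · rw [min_eq_right hl, List.getD_eq_default _ _ le_rfl, List.getD_eq_default _ _ hl]

/-- Set all bits to `false`. -/
theorem clear (d : ℕ) :
    Realizes (fun s => s.2.Inv d) fun s =>
      (false, s.2.setCells .array (List.replicate s.2.word.length false)) := by
  have body := ((Realizes.flag (H := Head) fun _ => false).seq (Realizes.write .array)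
    fun _ _ _ _ => trivial).seq (Realizes.right .array) fun _ _ _ _ => trivial
  refine (((body.loop (fun _ _ _ _ => trivial) .eof).seq (Realizes.home .array)
    fun _ _ _ _ => trivial).seq (Realizes.flag fun _ => false) fun _ _ _ _ => trivial).congr
      (fun _ _ _ _ => trivial) ?_
  intro N s hs h
  have hN : s.2.word.length = N := (hs .input).2
  have key : ∀ k ≤ N, ((fun s : St Head => (false, (s.2.setCells .array
      ((s.2.cells .array).set (s.2.pos .array) false)).right .array))^[k] s).2 =
      (s.2.setCells .array (List.replicate k false ++ (s.2.cells .array).drop k)).setPos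
        .array k := by
    intro k hk
    induction k with
    | zero =>
      simp only [Function.iterate_zero, List.replicate_zero, List.nil_append, List.drop_zero,
        Mem.setCells_self]
      exact (Mem.setPos_eq_self h.array).symm
    | succ k ih =>
      rw [Function.iterate_succ_apply', ih (by omega)]
      have e : (List.replicate k false ++ (s.2.cells .array).drop k).set k false =
          List.replicate (k + 1) false ++ (s.2.cells .array).drop (k + 1) := by
        have : k < (s.2.cells .array).length := by rw [(hs .array).2]; omega
        rw [List.drop_eq_getElem_cons this, List.set_append_right _ _ (by simp),
          List.length_replicate, Nat.sub_self, List.set_cons_zero, List.replicate_succ',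
          List.append_assoc]
        rfl
      simp only [Mem.right, Mem.setPos_pos_self, Mem.setPos_cells, Mem.setPos_setCells,
        Mem.setCells_cells_self, Mem.setCells_setCells, Mem.setPos_setPos, e]
      simp [(hs .array).2]
  rw [Prod.mk.injEq]
  refine ⟨rfl, ?_⟩
  rw [h.eof, hN, key N le_rfl, List.drop_eq_nil_of_le (hs .array).2.le, List.append_nil,
    Mem.setPos_setPos]
  exact Mem.setPos_eq_self h.array

end Realizes

namespace Decides

variable {d : ℕ} {P : List Bool → (ℕ → ℕ) → Prop}

/-- Set the bits of all values of the variable `d` that satisfy `P`. -/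
theorem realizes_markAll (hd : d < 12) (h : Decides (fun _ => True) (d + 1) P) :
    Realizes (fun s => s.2.Inv d) fun s =>
      (false, s.2.setCells .array (markAll (s.2.cells .array)
        fun v => P s.2.word (Function.update s.2.env d v))) := by
  classical
  let w : Head := .var ⟨d, hd⟩
  let b : St Head → St Head := fun s => (decide (P s.2.word s.2.env),
    (if P s.2.word s.2.env then s.2.setCells .array ((s.2.cells .array).set (s.2.env d) true)
      else s.2).right w)
  -- `h` makes no demand on the list of bits, so the tests can be made while that list is being
  -- changed.
  have body : Realizes (fun s => s.2.Inv (d + 1)) b := by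
    refine (((Realizes.congr h (fun _ _ _ h => ⟨h, trivial⟩) fun _ _ _ _ => rfl).seq
      (Realizes.ite (A := fun s => s.2.Inv (d + 1))
        ((Realizes.markAt (d + 1) (.var d)).congr (fun _ _ _ h => h.1) fun _ _ _ _ => rfl)
        Realizes.id.weaken) fun _ _ _ h => h).seq (Realizes.right w)
          fun _ _ _ _ => trivial).congr (fun _ _ _ h => h) ?_
    intro N s _ _
    by_cases e : P s.2.word s.2.env <;> simp [b, e, NumTerm.value, NumTerm.eval]
  have hb : ∀ N s, s.2.Valid N → s.2.Inv (d + 1) → (b s).2.Inv (d + 1) := by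
    intro N s _ h
    simp only [b]
    split_ifs
    · exact (h.setCells _).setPos_var hd (Nat.lt_succ_self d) _
    · exact h.setPos_var hd (Nat.lt_succ_self d) _
  refine (((body.loop hb .eof).seq (Realizes.home w) fun _ _ _ _ => trivial).seq
    (Realizes.flag fun _ => false) fun _ _ _ _ => trivial).congr
      (fun _ _ _ h => h.mono (Nat.le_succ d)) ?_
  intro N s hs h
  have hN : s.2.word.length = N := (hs .input).2
  have hv : s.2.pos w = 0 := by rw [← h.vars d le_rfl, Mem.env_eq hd]
  have key : ∀ k ≤ N, (b^[k] s).2 = (s.2.setCells .array (markAll (s.2.cells .array)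
      fun v => v < k ∧ P s.2.word (Function.update s.2.env d v))).setPos w k := by
    intro k hk
    induction k with
    | zero =>
      rw [markAll_of_forall_not _ (by simp), Mem.setCells_self]
      exact (Mem.setPos_eq_self hv).symm
    | succ k ih =>
      rw [Function.iterate_succ_apply']
      have e' : min (k + 1) N = k + 1 := by omega
      have hw : (s.2.cells w).length = N := (hs w).2
      have hc : ∀ l, (s.2.setCells .array l).cells w = s.2.cells w := by
        intro l; simp [Mem.setCells, w]
      simp only [b, ih (by omega), Mem.word_setPos, Mem.word_setCells, w, Mem.env_setPos_var,
        Mem.env_setCells, Mem.setPos_cells, Mem.setCells_cells_self, Function.update_self]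
      split_ifs with hP
      · rw [set_markAll _ _ _ hP]
        simp only [Mem.right, Mem.setPos_setCells, Mem.setCells_setCells, Mem.setPos_setPos,
          Mem.setPos_pos_self, Mem.setPos_cells]
        rw [hc, hw, e']
      · rw [markAll_succ _ _ _ hP]
        simp only [Mem.right, Mem.setPos_setPos, Mem.setPos_pos_self, Mem.setPos_cells]
        rw [hc, hw, e']
  rw [Prod.mk.injEq]
  refine ⟨rfl, ?_⟩
  rw [h.eof, hN, key N le_rfl, Mem.setPos_setPos, markAll_lt _ _ _ (hs .array).2.le]
  exact Mem.setPos_eq_self hv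

/-- One round of search. -/
theorem realizes_relax (hd : d + 1 < 12) (h : Decides (fun _ => True) (d + 2) P) :
    Realizes (fun s => s.2.Inv d) fun s =>
      (false, s.2.setCells .array (relax (fun u v => P s.2.word
        (Function.update (Function.update s.2.env d u) (d + 1) v)) (s.2.cells .array)
        s.2.word.length)) := by
  classical
  have hd' : d < 12 := by omega
  let w : Head := .var ⟨d, hd'⟩
  let b : St Head → St Head := fun s => (false,
    (if (s.2.cells .array).getD (s.2.env d) false = true then
      s.2.setCells .array (markAll (s.2.cells .array)
        fun v => P s.2.word (Function.update s.2.env (d + 1) v))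
      else s.2).right w)
  have body : Realizes (fun s => s.2.Inv (d + 1)) b := by
    refine (((Realizes.testAt (d + 1) (.var d)).seq
      (Realizes.ite (A := fun s => s.2.Inv (d + 1))
        ((realizes_markAll hd h).congr (fun _ _ _ h => h.1) fun _ _ _ _ => rfl)
        Realizes.id.weaken) fun _ _ _ h => h).seq (Realizes.right w)
          fun _ _ _ _ => trivial).congr (fun _ _ _ h => h) ?_
    intro N s _ _
    by_cases e : (s.2.cells .array).getD (s.2.env d) false = true
    · simp only [NumTerm.value, NumTerm.eval, b, e, if_true]
    · simp only [NumTerm.value, NumTerm.eval, b, e, if_false, Bool.false_eq_true]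
  have hb : ∀ N s, s.2.Valid N → s.2.Inv (d + 1) → (b s).2.Inv (d + 1) := by
    intro N s _ h
    simp only [b]
    split_ifs
    · exact (h.setCells _).setPos_var hd' (Nat.lt_succ_self d) _
    · exact h.setPos_var hd' (Nat.lt_succ_self d) _
  refine (((body.loop hb .eof).seq (Realizes.home w) fun _ _ _ _ => trivial).seq
    (Realizes.flag fun _ => false) fun _ _ _ _ => trivial).congr
      (fun _ _ _ h => h.mono (Nat.le_succ d)) ?_
  intro N s hs h
  have hN : s.2.word.length = N := (hs .input).2
  have hv : s.2.pos w = 0 := by rw [← h.vars d le_rfl, Mem.env_eq hd']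
  have key : ∀ k ≤ N, (b^[k] s).2 = (s.2.setCells .array (relax (fun u v => P s.2.word
        (Function.update (Function.update s.2.env d u) (d + 1) v)) (s.2.cells .array) k)).setPos
          w k := by
    intro k hk
    induction k with
    | zero =>
      rw [relax, Mem.setCells_self]
      exact (Mem.setPos_eq_self hv).symm
    | succ k ih =>
      rw [Function.iterate_succ_apply']
      have e' : min (k + 1) N = k + 1 := by omega
      have hw : (s.2.cells w).length = N := (hs w).2
      have hc : ∀ l, (s.2.setCells .array l).cells w = s.2.cells w := by
        intro l; simp [Mem.setCells, w]
      simp only [b, ih (by omega), Mem.word_setPos, Mem.word_setCells, w, Mem.env_setPos_var,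
        Mem.env_setCells, Mem.setPos_cells, Mem.setCells_cells_self, Function.update_self]
      rw [relax]
      split_ifs with hP
      · simp only [Mem.right, Mem.setPos_setCells, Mem.setCells_setCells, Mem.setPos_setPos,
          Mem.setPos_pos_self, Mem.setPos_cells]
        rw [hc, hw, e']
      · simp only [Mem.right, Mem.setPos_setPos, Mem.setPos_pos_self, Mem.setPos_cells]
        rw [hc, hw, e']
  rw [Prod.mk.injEq]
  refine ⟨rfl, ?_⟩
  rw [h.eof, hN, key N le_rfl, Mem.setPos_setPos]
  exact Mem.setPos_eq_self hv

/-- Reachability along a decidable relation between numbers below the length of the input. -/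
theorem reach (hd : d + 1 < 12) (h : Decides (fun _ => True) (d + 2) P) (t u : NumTerm) :
    Decides (fun a => ∀ b ∈ a, b = false) d fun x ρ =>
      t.eval x.length ρ < x.length ∧ u.eval x.length ρ < x.length ∧
        Relation.ReflTransGen (fun i j => i < x.length ∧ j < x.length ∧
          P x (Function.update (Function.update ρ d i) (d + 1) j))
          (t.eval x.length ρ) (u.eval x.length ρ) := by
  classical
  have round := realizes_relax hd h
  have hA : ∀ N (s : St Head), s.2.Valid N → s.2.Inv d → (s.2.setCells .array
      (relax (fun u v => P s.2.word (Function.update (Function.update s.2.env d u) (d + 1) v))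
        (s.2.cells .array) s.2.word.length)).Inv d :=
    fun N s _ h => h.setCells _
  -- `clear` overwrites the flag, which holds the answer. Branching on the flag and setting it again
  -- after clearing preserves it.
  have finish : Realizes (fun s => s.2.Inv d) fun s =>
      (s.1, s.2.setCells .array (List.replicate s.2.word.length false)) := by
    refine (Realizes.ite (((Realizes.clear d).congr (fun _ _ _ h => h.1) fun _ _ _ _ => rfl).seq
      (Realizes.flag fun _ => true) fun _ _ _ _ => trivial)
      ((Realizes.clear d).congr (fun _ _ _ h => h.1) fun _ _ _ _ => rfl)).congr
        (fun _ _ _ h => h) ?_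
    rintro N ⟨_ | _, μ⟩ _ _ <;> rfl
  have it : ∀ k (s : St Head), (((fun s : St Head => (false, s.2.setCells .array
      (relax (fun u v => P s.2.word (Function.update (Function.update s.2.env d u) (d + 1) v))
        (s.2.cells .array) s.2.word.length)))^[k] s).2 = s.2.setCells .array
      ((fun a => relax (fun u v => P s.2.word (Function.update (Function.update s.2.env d u)
        (d + 1) v)) a s.2.word.length)^[k] (s.2.cells .array))) := by
    intro k s
    induction k with
    | zero => simp [Mem.setCells_self]
    | succ k ih =>
      rw [Function.iterate_succ_apply', Function.iterate_succ_apply', ih]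
      simp
  -- The source is marked, `N` rounds are made, the target is read. All bits are `false` at the
  -- beginning by assumption, so clearing them restores the state, as `Decides` demands.
  refine ((((Realizes.markAt d t).seq (round.loop hA .eof) fun N s _ h => h.setCells _).seq
    (Realizes.testAt d u) fun N s _ h => ?_).seq finish fun N s _ h => ?_).congr
      (fun _ _ _ h => h.1) ?_
  · rw [it]; exact (h.setCells _).setCells _
  · rw [it]; exact (h.setCells _).setCells _
  · intro N s hs h
    have hN : s.2.word.length = N := (hs .input).2
    have ha : s.2.cells .array = List.replicate N false := by
      rw [← (hs .array).2]; exact List.eq_replicate_of_mem h.2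
    simp only [it]
    simp only [NumTerm.value, Mem.setCells_pos, Mem.env_setCells, Mem.word_setCells,
      Mem.setCells_cells_self, Mem.setCells_setCells, h.1.eof, hN, ha]
    rw [Prod.mk.injEq]
    constructor
    · rw [Bool.eq_iff_iff, decide_eq_true_iff]
      simpa only [hN] using getD_iterate_relax (fun u v => P s.2.word (Function.update
        (Function.update s.2.env d u) (d + 1) v)) N (t.eval N s.2.env) (u.eval N s.2.env)
    · rw [← ha, Mem.setCells_self]

end Decides

/-! ### From programs to the class P -/

open Turing

namespace Frag

variable {K : Type} [DecidableEq K]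

/-- Push the buffered symbol on all stacks in a list. -/
def pushAll (l : List K) : TM2.Stmt (fun _ : K => Bool) Unit Reg :=
  l.foldr (fun k q => .push k (fun v => v.2.getD false) q) (.load (fun v => (v.1, none)) .halt)

theorem stepAux_pushAll (l : List K) (hl : l.Nodup) (v : Reg) (S : K → List Bool) :
    TM2.stepAux (pushAll l) v S =
      ⟨none, (v.1, none), fun k => if k ∈ l then v.2.getD false :: S k else S k⟩ := by
  induction l generalizing S with
  | nil => simp [pushAll]
  | cons k l ih =>
    rw [List.nodup_cons] at hl
    change TM2.stepAux (pushAll l) v _ = _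
    rw [ih hl.2]
    congr 1
    funext j
    by_cases e : j = k
    · subst e; simp [hl.1]
    · simp [e]

/-- Used twice: with the left stacks of all heads to distribute the input, and with `l = []` to
empty a stack. -/
theorem run_whilePop_pushAll {k : K} {l : List K} (hl : l.Nodup) (hk : k ∉ l) (x : List Bool) :
    ∀ (v : Reg) (S : K → List Bool), S k = x →
    (whilePop k (atom (pushAll l))).Run (2 * x.length + 1) (v, S)
      ((v.1, none), fun j => if j = k then [] else if j ∈ l then x.reverse ++ S j else S j) := by
  induction x with
  | nil =>
    intro v S h
    have : (fun j => if j = k then [] else if j ∈ l then [].reverse ++ S j else S j) = S := by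
      funext j
      by_cases e : j = k
      · subst e; simp [h]
      · simp [e]
    rw [this]
    exact run_whilePop_nil h
  | cons b x ih =>
    intro v S h
    have e := run_whilePop_cons h (v := v) (n := 1) (run_atom (b := ((v.1, none), fun j =>
      if j ∈ l then b :: Function.update S k x j else Function.update S k x j))
      (stepAux_pushAll l hl _ _)) (ih _ _ (by simp [hk]))
    refine cast ?_ (e.mono (show _ ≤ 2 * (b :: x).length + 1 by simp; omega))
    congr 2
    funext j
    by_cases h1 : j = k
    · simp [h1]
    · by_cases h2 : j ∈ l <;> simp [h1, h2]

/-- Empty all stacks in a list. -/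
def clean (l : List K) : Frag K :=
  l.foldr (fun k F => seq (whilePop k (atom (pushAll []))) F) (atom (.load (fun v => (v.1, none)) .halt))

theorem run_clean (l : List K) (N : ℕ) : ∀ (v : Reg) (S : K → List Bool),
    (∀ k, (S k).length ≤ N) →
    (clean l).Run (l.length * (2 * N + 1) + 1) (v, S)
      ((v.1, none), fun k => if k ∈ l then [] else S k) := by
  induction l with
  | nil =>
    intro v S _
    exact (run_atom (by simp)).mono (by simp)
  | cons k l ih =>
    intro v S hS
    have h1 := run_whilePop_pushAll (l := []) List.nodup_nil (List.not_mem_nil (a := k)) (S k) v S rfl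
    have h2 := ih (v.1, none)
      (fun j => if j = k then [] else if j ∈ [] then (S k).reverse ++ S j else S j) (by
        intro j
        split_ifs with h
        · simp
        · simp_all
        · exact hS j)
    refine cast ?_ ((run_seq h1 h2).mono
      (show _ ≤ (k :: l).length * (2 * N + 1) + 1 from ?_))
    · congr 2
      funext j
      by_cases h1 : j = k
      · simp [h1]
      · by_cases h2 : j ∈ l <;> simp [h1, h2]
    · have := hS k
      rw [List.length_cons, Nat.add_mul, Nat.one_mul]
      omega

theorem Steps.iterate {Λ : Type} {M : Λ → TM2.Stmt (fun _ : K => Bool) Λ Reg} {n c c'}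
    (h : Steps M n c c') : (flip bind (TM2.step M))^[n] (some c) = some c' := by
  induction h with
  | refl => rfl
  | head _ ih => rw [Function.iterate_succ_apply]; exact ih

end Frag

theorem Realizes.homes (l : List Head) :
    Realizes (fun _ => True) fun s : St Head =>
      (s.1, ⟨fun h => if h ∈ l then 0 else s.2.pos h, s.2.cells⟩) := by
  induction l with
  | nil => exact Realizes.id.congr (fun _ _ _ _ => trivial) fun _ _ _ _ => by simp
  | cons h l ih =>
    refine (ih.seq (Realizes.home h) fun _ _ _ _ => trivial).congr (fun _ _ _ _ => trivial) ?_
    intro N s _ _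
    rw [Prod.mk.injEq]
    refine ⟨rfl, ?_⟩
    ext1
    · funext j
      by_cases e : j = h
      · subst e; simp [Mem.setPos]
      · simp [Mem.setPos, e]
    · rfl

/-- Properties decided by programs without parameters are in P. -/
theorem inP_of_decides {P : List Bool → (ℕ → ℕ) → Prop}
    (h : Decides (fun a => ∀ b ∈ a, b = false) 0 P) {L : Language Bool}
    (hL : ∀ x, P x (fun _ => 0) ↔ x ∈ L) : InP L := by
  classical
  -- Popping the input and pushing it on every left stack puts a copy of `x` under each head, with
  -- the head at the end. The head `eof` stays there; all others have to be sent home, and the list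
  -- of bits has to be cleared.
  let start : List Bool → Mem Head := fun x => ⟨fun _ => x.length, fun _ => x⟩
  have hstart : ∀ x, (start x).Valid x.length := fun x h => ⟨le_rfl, rfl⟩
  obtain ⟨g, hg, hgx⟩ : ∃ g : St Head → St Head,
      Realizes (fun s => ∃ x, s = (false, start x)) g ∧
        ∀ x, (g (false, start x)).1 = decide (x ∈ L) := by
    refine ⟨_, (((Realizes.homes (Finset.univ.erase Head.eof).toList).congr
      (A := fun _ => True) (B := fun s => ∃ x, s = (false, start x))
      (fun _ _ _ _ => trivial) fun _ _ _ _ => rfl).seq (Realizes.clear 0) ?_).seq h ?_, ?_⟩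
    · rintro N _ - ⟨x, rfl⟩
      refine ⟨?_, ?_, ?_, ?_, ?_⟩
      · simp [start, Mem.word]
      · simp
      · simp
      · simp
      · intro i _
        simp [Mem.env]
    · rintro N _ - ⟨x, rfl⟩
      refine ⟨Mem.Inv.setCells ⟨?_, ?_, ?_, ?_, ?_⟩ _, ?_⟩
      · simp [start, Mem.word]
      · simp
      · simp
      · simp
      · intro i _
        simp [Mem.env]
      · intro b hb
        simp only [Mem.setCells_cells_self] at hb
        exact List.eq_of_mem_replicate hb
    · intro x
      rw [decide_eq_decide, ← hL x]
      have e : ∀ (μ : Mem Head), (∀ i, μ.pos (.var i) = 0) → μ.env = fun _ => 0 := by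
        intro μ hμ; funext i; simp [Mem.env, hμ]
      rw [e _ (by simp)]
      simp [start, Mem.word, Mem.setCells]
  obtain ⟨D, T, hg⟩ := hg
  obtain ⟨F, hF⟩ := hg D le_rfl
  let tapes : List (Stk Head D) := (Finset.univ : Finset Head).toList.map fun h =>
    some (.inl (h, false))
  have htapes : tapes.Nodup := (Finset.nodup_toList _).map (by intro a b; simp)
  have hmem : ∀ h b, some (.inl (h, b)) ∈ tapes ↔ b = false := by
    intro h b; simp [tapes, eq_comm]
  have hmem' : ∀ i, some (.inr i) ∉ tapes := by intro i; simp [tapes]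
  let all : List (Stk Head D) := Finset.univ.toList
  -- `haltList` requires every stack other than the output to be empty and the initial internal
  -- state to be restored; hence the cleaning and the final `load`.
  let G : Frag (Stk Head D) := .seq (.whilePop none (.atom (Frag.pushAll tapes)))
    (.seq F (.seq (.clean all) (.atom (.push none (fun v => v.1) (.load (fun _ => (false, none)) .halt)))))
  let T' : Polynomial ℕ := 2 * .X + 1 + (T + ((all.length : Polynomial ℕ) * (2 * .X + 1) + 1 + 1))
  have hG : ∀ x : List Bool, G.Run (T'.eval x.length)
      ((false, none), fun k => if k = none then x else [])
      ((false, none), fun k => if k = none then [decide (x ∈ L)] else []) := by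
    intro x
    have r1 := Frag.run_whilePop_pushAll htapes (k := none) (by simp [tapes]) x (false, none)
      (fun k => if k = none then x else []) (by simp)
    have r1' : (Frag.whilePop none (.atom (Frag.pushAll tapes))).Run (2 * x.length + 1)
        ((false, none), fun k => if k = none then x else [])
        ((false, none), (start x).stacks fun _ => []) := by
      refine cast ?_ r1
      congr 2
      funext k
      rcases k with _ | ⟨⟨h, _ | _⟩⟩ | i
      · simp [Mem.stacks]
      · simp [Mem.stacks, hmem, start]
      · simp [Mem.stacks, hmem, start]
      · simp [Mem.stacks, hmem']
    obtain ⟨hv, r2⟩ := hF x.length (false, start x) (fun _ => []) (hstart x) ⟨x, rfl⟩ fun _ _ => rfl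
    have r3 := Frag.run_clean all x.length ((g (false, start x)).1, none)
      ((g (false, start x)).2.stacks fun _ : Fin D => []) (by
        intro k
        rcases k with _ | ⟨⟨h, _ | _⟩⟩ | i
        · simp [Mem.stacks]
        · simp [Mem.stacks, (hv h).2]
        · simp [Mem.stacks, (hv h).2]
        · simp [Mem.stacks])
    refine (Frag.run_seq r1' (Frag.run_seq r2 (Frag.run_seq r3 (Frag.run_atom ?_)))).mono ?_
    · simp only [TM2.stepAux, hgx]
      congr 1
      funext k
      by_cases e : k = none
      · subst e; simp [all]
      · simp [e, all]
    · simp [T']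
  let := G.fin
  let tm : FinTM2 :=
    { K := Stk Head D
      k₀ := none
      k₁ := none
      Γ := fun _ => Bool
      Λ := G.Λ
      main := G.entry
      σ := Reg
      initialState := (false, none)
      m := G.code }
  have run : ∀ x : List Bool, Nonempty (TM2OutputsInTime tm (x.map (Equiv.refl Bool).invFun)
      (some ((Computability.encodeBool (decide (x ∈ L))).map (Equiv.refl Bool).invFun))
      (T'.eval x.length)) := by
    intro x
    obtain ⟨k, hk, hs⟩ := hG x
    refine ⟨⟨⟨k, ?_⟩, hk⟩⟩
    have h1 : initList tm (x.map (Equiv.refl Bool).invFun) =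
        ⟨some G.entry, (false, none), fun k => if k = none then x else []⟩ := by
      simp only [initList, tm]
      congr 1
      funext k
      by_cases e : k = none
      · subst e; simp
      · simp [e]
    have h2 : haltList tm ((Computability.encodeBool (decide (x ∈ L))).map (Equiv.refl Bool).invFun) =
        ⟨none, (false, none), fun k => if k = none then [decide (x ∈ L)] else []⟩ := by
      simp only [haltList, tm]
      congr 1
    rw [h1, Option.map_some, h2]
    exact hs.iterate
  exact ⟨fun x => decide (x ∈ L), fun x => by simp,
    { tm := tm
      inputAlphabet := Equiv.refl Bool
      outputAlphabet := Equiv.refl Bool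
      time := T'
      outputsFun := fun x => (run x).some }, fun _ => inferInstanceAs (Finite Bool)⟩

/-! ### Single-peakedness as a two-colouring problem -/

open Relation

/-- To construct a colouring, choose a representative `r` in each component of `C`, give it the
colour `true`, and give `a` the colour `s` for which `(r, true)` reaches `(a, s)`. By `symm` and
`flip`, reaching both colours of `a` would connect `(a, true)` with `(a, false)`. Conversely, for a
colouring `f` the truth value of `f a = s` is constant along paths, but it differs at `(c, true)`
and `(c, false)`. -/
theorem reflTransGen_prod_bool_iff_coloring {C : Type} (E : C × Bool → C × Bool → Prop)
    (symm : ∀ x y, E x y → E y x)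
    (flip : ∀ a s b t, E (a, s) (b, t) → E (a, !s) (b, !t)) :
    (∀ c, ¬ ReflTransGen E (c, true) (c, false)) ↔
      ∃ f : C → Bool, ∀ a s b t, E (a, s) (b, t) → (f a = s ↔ f b = t) := by
  classical
  have rsymm : ∀ {x y}, ReflTransGen E x y → ReflTransGen E y x := by
    intro x y h
    induction h with
    | refl => exact .refl
    | tail _ hyz ih => exact .head (symm _ _ hyz) ih
  have rflip : ∀ {a s b t}, ReflTransGen E (a, s) (b, t) → ReflTransGen E (a, !s) (b, !t) := by
    intro a s b t h
    exact h.lift (fun x : C × Bool => (x.1, !x.2)) fun x y h => flip _ _ _ _ h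
  constructor
  · intro hc
    let S : Setoid C :=
      { r := fun a b => ∃ s, ReflTransGen E (a, true) (b, s)
        iseqv :=
          { refl := fun a => ⟨true, .refl⟩
            symm := by
              rintro a b ⟨_ | _, h⟩
              · exact ⟨false, rsymm (rflip h)⟩
              · exact ⟨true, rsymm h⟩
            trans := by
              rintro a b c ⟨_ | _, h⟩ ⟨t, h'⟩
              · exact ⟨!t, h.trans (rflip h')⟩
              · exact ⟨t, h.trans h'⟩ } }
    let r : C → C := fun a => (Quotient.mk S a).out
    have hr : ∀ a, ∃ s, ReflTransGen E (r a, true) (a, s) := fun a => Quotient.mk_out (s := S) a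
    have hu : ∀ a, ReflTransGen E (r a, true) (a, true) → ¬ ReflTransGen E (r a, true) (a, false) :=
      fun a h h' => hc a ((rsymm h).trans h')
    have hf : ∀ a s, (decide (ReflTransGen E (r a, true) (a, true)) = s ↔
        ReflTransGen E (r a, true) (a, s)) := by
      rintro a (_ | _)
      · rw [decide_eq_false_iff_not]
        refine ⟨fun h => ?_, fun h h' => hu a h' h⟩
        obtain ⟨_ | _, hs⟩ := hr a
        · exact hs
        · exact absurd hs h
      · rw [decide_eq_true_iff]
    refine ⟨fun a => decide (ReflTransGen E (r a, true) (a, true)), fun a s b t h => ?_⟩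
    have hab : r a = r b := by
      have : S.r a b := by
        cases s
        · exact ⟨_, .single (flip _ _ _ _ h)⟩
        · exact ⟨_, .single h⟩
      exact congrArg Quotient.out (Quotient.sound this)
    rw [hf, hf, hab]
    exact ⟨fun h' => h'.tail h, fun h' => h'.tail (symm _ _ h)⟩
  · rintro ⟨f, hf⟩ c h
    have key : ∀ y, ReflTransGen E (c, true) y → (f c = true ↔ f y.1 = y.2) := by
      intro y h
      induction h with
      | refl => exact Iff.rfl
      | @tail y z _ hyz ih => exact ih.trans (hf y.1 y.2 z.1 z.2 hyz)
    have := key _ h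
    cases hfc : f c <;> simp [hfc] at this

/-! ### Ranks of weak orders, and single-peakedness as absence of valleys. -/

namespace WeakOrder

variable {C : Type}

theorem asymm (v : WeakOrder C) {a b : C} (h : v.prefers a b) : ¬ v.prefers b a :=
  fun h' => v.irrefl a (v.trans a b a h h')

/-- Transitivity of indifference enters the combinatorial argument only here. It makes `rank`
represent `v`, so that comparisons of candidates become linear arithmetic. -/
theorem not_prefers_trans (v : WeakOrder C) {a b c : C} (h : ¬ v.prefers a b)
    (h' : ¬ v.prefers b c) : ¬ v.prefers a c := by
  intro hac
  by_cases hba : v.prefers b a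
  · exact h' (v.trans b a c hba hac)
  · by_cases hcb : v.prefers c b
    · exact h (v.trans a c b hac hcb)
    · exact (v.indiff_trans a b c ⟨h, hba⟩ ⟨h', hcb⟩).1 hac

open scoped Classical in
/-- The number of candidates that are worse than `c`. -/
noncomputable def rank [Fintype C] (v : WeakOrder C) (c : C) : ℕ :=
  (Finset.univ.filter fun d => v.prefers c d).card

theorem prefers_iff_rank_lt [Fintype C] (v : WeakOrder C) (a b : C) :
    v.prefers a b ↔ v.rank b < v.rank a := by
  classical
  constructor
  · intro h
    refine Finset.card_lt_card ⟨fun d hd => ?_, fun hsub => ?_⟩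
    · simp only [Finset.mem_filter, Finset.mem_univ, true_and] at hd ⊢
      exact v.trans a b d h hd
    · have : b ∈ Finset.univ.filter fun d => v.prefers b d := hsub (by simpa using h)
      exact v.irrefl b (by simpa using this)
  · intro h
    by_contra hab
    refine absurd (Finset.card_le_card fun d hd => ?_) (not_le_of_gt h)
    simp only [Finset.mem_filter, Finset.mem_univ, true_and] at hd ⊢
    by_contra hbd
    exact v.not_prefers_trans hab hbd hd

theorem rank_lt_card [Fintype C] (v : WeakOrder C) (c : C) : v.rank c < Fintype.card C := by
  classical
  refine Finset.card_lt_card ⟨Finset.filter_subset _ _, fun h => ?_⟩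
  have := h (Finset.mem_univ c)
  exact v.irrefl c (by simpa using this)

/-- The positions on an axis, and the position of the peak, of a single-peaked voter. -/
theorem SinglePeakedOn.exists_peak_position {v : WeakOrder C} {A : List C}
    (h : v.SinglePeakedOn A) (hA : A.Nodup) :
    ∃ q, (∀ i j (hi : i < j) (hj : j < A.length), j ≤ q → v.prefers A[j] A[i]) ∧
      ∀ i j (hi : i < j) (hj : j < A.length), q ≤ i → v.prefers A[i] A[j] := by
  obtain ⟨p, X, Y, hp, rfl, hX, hY⟩ := h
  have hXp : (X ++ [p]).Pairwise fun a b => v.prefers b a := by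
    refine List.pairwise_append.2 ⟨hX, List.pairwise_singleton _ _, fun a ha b hb => ?_⟩
    obtain rfl := List.mem_singleton.1 hb
    refine hp a ?_
    rintro rfl
    exact (List.nodup_append.1 hA).2.2 a ha a (by simp) rfl
  have hpY : (p :: Y).Pairwise fun a b => v.prefers a b := by
    refine List.pairwise_cons.2 ⟨fun a ha => hp a ?_, hY⟩
    rintro rfl
    exact (List.nodup_cons.1 (List.nodup_append.1 hA).2.1).1 ha
  refine ⟨X.length, fun i j hi hj hq => ?_, fun i j hi hj hq => ?_⟩
  · have := List.pairwise_iff_getElem.1 hXp i j (by simp; omega) (by simp; omega) hi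
    have e : X ++ p :: Y = (X ++ [p]) ++ Y := by simp
    simp only [e]
    rwa [List.getElem_append_left (as := X ++ [p]) (i := i) (by simp; omega),
      List.getElem_append_left (as := X ++ [p]) (i := j) (by simp; omega)]
  · have := List.pairwise_iff_getElem.1 hpY (i - X.length) (j - X.length)
      (by simp at hj ⊢; omega) (by simp at hj ⊢; omega) (by omega)
    rwa [List.getElem_append_right (by omega), List.getElem_append_right (by omega)]

/-- Split `A` at the peak `p`. If `a` and then `b` come before `p`, the absence of a valley at `b`
gives that `b` beats `a`, since it cannot beat `p`; the right side is symmetric. -/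
theorem singlePeakedOn_of_pairwise {v : WeakOrder C} {A : List C} (hA : IsAxis A)
    (hp : ∃ p, v.IsPeak p) (f : C → ℤ) (hf : A.Pairwise fun a b => f a < f b)
    (hv : ∀ a b c, f a < f b → f b < f c → v.prefers b a ∨ v.prefers b c) :
    v.SinglePeakedOn A := by
  obtain ⟨p, hp⟩ := hp
  obtain ⟨X, Y, rfl⟩ := List.append_of_mem (hA.2 p)
  obtain ⟨hX, hY, hXY⟩ := List.pairwise_append.1 hf
  rw [List.pairwise_cons] at hY
  have hne : ∀ c, f c ≠ f p → ¬ v.prefers c p := fun c hc =>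
    v.asymm (hp c (by rintro rfl; exact hc rfl))
  refine ⟨p, X, Y, hp, rfl, ?_, ?_⟩
  · refine hX.imp_of_mem fun {a b} ha hb hab => ?_
    have hbp := hXY b hb p (by simp)
    exact (hv a b p hab hbp).resolve_right (hne b hbp.ne)
  · refine hY.2.imp_of_mem fun {a b} ha hb hab => ?_
    have hpa := hY.1 a ha
    exact (hv p a b hpa hab).resolve_left (hne a hpa.ne')

end WeakOrder

/-! ### The constraints on the sides of the peak of a reference voter. -/

section Sides

variable {C : Type} (v : WeakOrder C) (V : Multiset (WeakOrder C))

/-- On every axis for `V`, the candidates `a` and `b` are on different sides of the peak of `v`: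
they are indifferent for `v`, or another candidate forces this. -/
def MustDiffer (a b : C) : Prop :=
  a ≠ b ∧ ((¬ v.prefers a b ∧ ¬ v.prefers b a) ∨
    ∃ c, c ≠ a ∧ c ≠ b ∧ ¬ v.prefers a b ∧ ¬ v.prefers b c ∧
      ∃ w ∈ V, ¬ w.prefers b a ∧ ¬ w.prefers b c)

/-- On every axis for `V`, the candidates `a` and `b` are on the same side of the peak of `v`,
because of another candidate. -/
def MustAgree (a b : C) : Prop :=
  ∃ c, c ≠ a ∧ c ≠ b ∧ ¬ v.prefers a b ∧ ¬ v.prefers b c ∧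
    ∃ w ∈ V, ¬ w.prefers c a ∧ ¬ w.prefers c b

/-- The constraints as a relation between sides of candidates. -/
def SideLink (x y : C × Bool) : Prop :=
  if x.2 = y.2 then MustAgree v V x.1 y.1 ∨ MustAgree v V y.1 x.1
  else MustDiffer v V x.1 y.1 ∨ MustDiffer v V y.1 x.1

variable {v V}

/-- The colour of a candidate tells whether it is left of the peak position `q` of `v`. Two
candidates on one side have different ranks. In a triple with ranks rising from `a` over `b` to `c`,
equal sides of `a` and `b` would put `b` in the middle, and different sides would put `c` there;
either can be excluded by a valley of `w`. -/
theorem sides_of_singlePeaked [Fintype C] {A : List C} (hA : IsAxis A)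
    (hV : ∀ w ∈ V, w.SinglePeakedOn A) (hv : v ∈ V) :
    ∃ f : C → Bool, (∀ a b, MustDiffer v V a b → f a ≠ f b) ∧
      ∀ a b, MustAgree v V a b → f a = f b := by
  classical
  obtain ⟨g, hinj, pos⟩ : ∃ g : C → ℕ, (∀ a b, g a = g b → a = b) ∧
      ∀ w ∈ V, ∃ q, (∀ a b, g a < g b → g b ≤ q → w.prefers b a) ∧
        ∀ a b, g a < g b → q ≤ g a → w.prefers a b := by
    have hlen : ∀ c, A.idxOf c < A.length := fun c => List.idxOf_lt_length_of_mem (hA.2 c)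
    have hget : ∀ c, A[A.idxOf c]'(hlen c) = c := fun c => List.getElem_idxOf (hlen c)
    refine ⟨A.idxOf, fun a b h => ?_, fun w hw => ?_⟩
    · rw [← hget a, ← hget b]; congr
    · obtain ⟨q, h1, h2⟩ := (hV w hw).exists_peak_position hA.1
      refine ⟨q, fun a b hab hq => ?_, fun a b hab hq => ?_⟩
      · simpa only [hget] using h1 _ _ hab (hlen b) hq
      · simpa only [hget] using h2 _ _ hab (hlen b) hq
  have valley : ∀ w ∈ V, ∀ a b c, g a < g b → g b < g c → w.prefers b a ∨ w.prefers b c := by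
    intro w hw a b c hab hbc
    obtain ⟨q, h1, h2⟩ := pos w hw
    rcases le_total (g b) q with h | h
    · exact .inl (h1 a b hab h)
    · exact .inr (h2 b c hbc h)
  obtain ⟨q, h1, h2⟩ := pos v hv
  simp only [WeakOrder.prefers_iff_rank_lt] at h1 h2
  refine ⟨fun c => decide (g c < q), ?_, ?_⟩
  · rintro a b ⟨hab, h⟩
    have gab : g a ≠ g b := fun e => hab (hinj a b e)
    rw [Ne, decide_eq_decide]
    intro hs
    rcases h with ⟨h3, h4⟩ | ⟨c, hca, hcb, h3, h4, w, hw, h5, h6⟩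
    · rw [WeakOrder.prefers_iff_rank_lt] at h3 h4
      have := h1 a b
      have := h1 b a
      have := h2 a b
      have := h2 b a
      omega
    · rw [WeakOrder.prefers_iff_rank_lt] at h3 h4
      have gca : g c ≠ g a := fun e => hca (hinj c a e)
      have gcb : g c ≠ g b := fun e => hcb (hinj c b e)
      have e1 : ¬ (g a < g b ∧ g b < g c) := fun h => (valley w hw a b c h.1 h.2).elim h5 h6
      have e2 : ¬ (g c < g b ∧ g b < g a) := fun h => (valley w hw c b a h.1 h.2).elim h6 h5
      have := h1 b a
      have := h1 c b
      have := h2 a b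
      have := h2 b c
      omega
  · rintro a b ⟨c, hca, hcb, h3, h4, w, hw, h5, h6⟩
    rw [WeakOrder.prefers_iff_rank_lt] at h3 h4
    have gca : g c ≠ g a := fun e => hca (hinj c a e)
    have gcb : g c ≠ g b := fun e => hcb (hinj c b e)
    have e1 : ¬ (g a < g c ∧ g c < g b) := fun h => (valley w hw a c b h.1 h.2).elim h5 h6
    have e2 : ¬ (g b < g c ∧ g c < g a) := fun h => (valley w hw b c a h.1 h.2).elim h6 h5
    have := h1 c a
    have := h1 c b
    have := h2 a c
    have := h2 b c
    rw [decide_eq_decide]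
    omega

/-- The axis sorts the candidates by `g`, whose sign is the side and whose absolute value is `card C
- rank`, positive by `rank_lt_card`. Candidates that are better for `v` are thus closer to the
centre. Ties in rank are separated by sign, so `g` is injective. -/
theorem singlePeaked_of_sides [Fintype C] (hp : ∀ w ∈ V, ∃ p, w.IsPeak p) {f : C → Bool}
    (hd : ∀ a b, MustDiffer v V a b → f a ≠ f b) (ha : ∀ a b, MustAgree v V a b → f a = f b) :
    SinglePeaked V := by
  classical
  let g : C → ℤ := fun c =>
    if f c = true then (v.rank c : ℤ) - Fintype.card C else Fintype.card C - v.rank c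
  have hg : ∀ c, (f c = true ∧ g c = (v.rank c : ℤ) - Fintype.card C) ∨
      (f c = false ∧ g c = Fintype.card C - v.rank c) := by
    intro c
    cases h : f c <;> simp [g, h]
  have hr : ∀ c, v.rank c < Fintype.card C := v.rank_lt_card
  have hinj : Function.Injective g := by
    intro a b hab
    by_contra hne
    have := hr a
    have := hr b
    have e : v.rank a = v.rank b ∧ f a = f b := by
      rcases hg a with ⟨h1, h2⟩ | ⟨h1, h2⟩ <;> rcases hg b with ⟨h3, h4⟩ | ⟨h3, h4⟩ <;>
        rw [h1, h3] <;> refine ⟨?_, ?_⟩ <;> first | rfl | omega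
    refine hd a b ⟨hne, .inl ?_⟩ e.2
    simp [WeakOrder.prefers_iff_rank_lt, e.1]
  -- The case where an end `a` of the triple has least rank. A valley at the middle `b` yields
  -- `MustDiffer` for `a`, `b` or `MustAgree` for `a`, `c`, according to which of `b`, `c` has the
  -- smaller rank, and both contradict the position of `b`.
  have outer : ∀ w ∈ V, ∀ a b c, a ≠ b → a ≠ c → b ≠ c → v.rank a ≤ v.rank b → v.rank a ≤ v.rank c →
      ((g a < g b ∧ g b < g c) ∨ (g c < g b ∧ g b < g a)) →
      ¬ (¬ w.prefers b a ∧ ¬ w.prefers b c) := by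
    rintro w hw a b c hab hac hbc h1 h2 h3 ⟨h4, h5⟩
    have := hr a
    have := hr b
    have := hr c
    rcases le_total (v.rank b) (v.rank c) with h | h
    · have : f a ≠ f b := hd a b ⟨hab, .inr ⟨c, hac.symm, hbc.symm,
        by rw [WeakOrder.prefers_iff_rank_lt]; omega,
        by rw [WeakOrder.prefers_iff_rank_lt]; omega, w, hw, h4, h5⟩⟩
      rcases hg a with ⟨e1, e2⟩ | ⟨e1, e2⟩ <;> rcases hg b with ⟨e3, e4⟩ | ⟨e3, e4⟩ <;>
        rcases hg c with ⟨e5, e6⟩ | ⟨e5, e6⟩ <;> first | exact this (e1.trans e3.symm) | omega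
    · have : f a = f c := ha a c ⟨b, hab.symm, hbc,
        by rw [WeakOrder.prefers_iff_rank_lt]; omega,
        by rw [WeakOrder.prefers_iff_rank_lt]; omega, w, hw, h4, h5⟩
      rcases hg a with ⟨e1, e2⟩ | ⟨e1, e2⟩ <;> rcases hg b with ⟨e3, e4⟩ | ⟨e3, e4⟩ <;>
        rcases hg c with ⟨e5, e6⟩ | ⟨e5, e6⟩ <;>
        first
        | omega
        | exact absurd (e1.symm.trans (this.trans e5)) (by simp)
  have valley : ∀ w ∈ V, ∀ a b c, g a < g b → g b < g c → w.prefers b a ∨ w.prefers b c := by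
    intro w hw a b c hab hbc
    by_contra hcon
    rw [not_or] at hcon
    have nab : a ≠ b := by rintro rfl; exact lt_irrefl _ hab
    have nbc : b ≠ c := by rintro rfl; exact lt_irrefl _ hbc
    have nac : a ≠ c := by rintro rfl; exact lt_asymm hab hbc
    have := hr a
    have := hr b
    have := hr c
    by_cases h1 : v.rank a ≤ v.rank b ∧ v.rank a ≤ v.rank c
    · exact outer w hw a b c nab nac nbc h1.1 h1.2 (.inl ⟨hab, hbc⟩) hcon
    · by_cases h2 : v.rank c ≤ v.rank b ∧ v.rank c ≤ v.rank a
      · exact outer w hw c b a nbc.symm nac.symm nab.symm h2.1 h2.2 (.inr ⟨hab, hbc⟩) hcon.symm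
      -- Now `b` alone has the least rank, hence the greatest absolute value of `g`, and cannot be
      -- in the middle.
      · rcases hg a with ⟨e1, e2⟩ | ⟨e1, e2⟩ <;> rcases hg b with ⟨e3, e4⟩ | ⟨e3, e4⟩ <;>
          rcases hg c with ⟨e5, e6⟩ | ⟨e5, e6⟩ <;> omega
  let A := (Finset.univ : Finset C).toList.mergeSort fun a b => decide (g a ≤ g b)
  have hAp : A.Perm (Finset.univ : Finset C).toList := List.mergeSort_perm _ _
  have hA : IsAxis A :=
    ⟨hAp.nodup_iff.2 (Finset.nodup_toList _), fun c => hAp.mem_iff.2 (by simp)⟩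
  have hAs : A.Pairwise fun a b => g a < g b := by
    have h1 : A.Pairwise fun a b => decide (g a ≤ g b) = true :=
      List.pairwise_mergeSort (by simp; intro a b c; exact le_trans) (by simp [le_total]) _
    refine h1.imp₂ (fun a b h h' => ?_) hA.1
    exact lt_of_le_of_ne (by simpa using h) fun e => h' (hinj e)
  exact ⟨A, hA, fun w hw => WeakOrder.singlePeakedOn_of_pairwise hA (hp w hw) g hAs (valley w hw)⟩

/-- Any single voter serves as reference; the other voters enter through the valleys in the
constraints. -/
theorem singlePeaked_iff_not_reachable [Fintype C] (hv : v ∈ V) :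
    SinglePeaked V ↔ (∀ w ∈ V, ∃ p, w.IsPeak p) ∧
      ∀ c, ¬ ReflTransGen (SideLink v V) (c, true) (c, false) := by
  have symm : ∀ x y, SideLink v V x y → SideLink v V y x := by
    intro x y h
    unfold SideLink at h ⊢
    by_cases e : x.2 = y.2
    · rw [if_pos e] at h; rw [if_pos e.symm]; exact h.symm
    · rw [if_neg e] at h; rw [if_neg (Ne.symm e)]; exact h.symm
  have flip : ∀ a s b t, SideLink v V (a, s) (b, t) → SideLink v V (a, !s) (b, !t) := by
    intro a s b t h
    simpa [SideLink] using h
  rw [reflTransGen_prod_bool_iff_coloring _ symm flip]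
  constructor
  · rintro ⟨A, hA, hV⟩
    refine ⟨fun w hw => ?_, ?_⟩
    · obtain ⟨p, _, _, hp, _⟩ := hV w hw
      exact ⟨p, hp⟩
    · obtain ⟨f, hd, ha⟩ := sides_of_singlePeaked hA hV hv
      refine ⟨f, fun a s b t h => ?_⟩
      unfold SideLink at h
      dsimp only at h
      split_ifs at h with e
      · have : f a = f b := h.elim (ha a b) fun h => (ha b a h).symm
        rw [this, e]
      · have : f a ≠ f b := h.elim (hd a b) fun h => (hd b a h).symm
        clear symm flip hd ha h
        revert this e
        cases f a <;> cases f b <;> cases s <;> cases t <;> simp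
  · rintro ⟨hp, f, hf⟩
    refine singlePeaked_of_sides (v := v) hp (f := f) (fun a b h e => ?_) fun a b h => ?_
    · have := hf a true b false (by simp only [SideLink]; exact .inl h)
      cases hb : f b <;> simp [e, hb] at this
    · have := hf a true b true (by simp only [SideLink, if_true]; exact .inl h)
      cases ha : f a <;> cases hb : f b <;> simp [ha, hb] at this ⊢

end Sides

/-! ### Words that describe profiles -/

theorem List.getD_flatMap_of_length {α β : Type} (f : α → List β) (d : β) (L : ℕ) (l : List α)
    (hf : ∀ a ∈ l, (f a).length = L) (i j : ℕ) (hi : i < l.length) (hj : j < L) :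
    (l.flatMap f).getD (L * i + j) d = (f l[i]).getD j d := by
  induction l generalizing i with
  | nil => simp at hi
  | cons a l ih =>
    have ha : (f a).length = L := hf a (by simp)
    rw [List.flatMap_cons]
    cases i with
    | zero =>
      rw [Nat.mul_zero, Nat.zero_add, List.getD_append _ _ _ _ (by omega)]
      rfl
    | succ i =>
      rw [List.getD_append_right _ _ _ _ (by rw [ha, Nat.mul_succ]; omega), ha,
        show L * (i + 1) + j - L = L * i + j by rw [Nat.mul_succ]; omega]
      exact ih (fun a ha => hf a (by simp [ha])) i (by simpa using hi)

/-- `x` is `1ⁿ 0 1ᵐ 0` followed by `m` times `n * n` bits. -/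
def HasHeader (x : List Bool) (n m : ℕ) : Prop :=
  (∀ i < n, x.getD i false = true) ∧ ¬ x.getD n false = true ∧
    (∀ i < m, x.getD (n + (1 + i)) false = true) ∧ ¬ x.getD (n + (1 + m)) false = true ∧
      x.length = n + (m + (2 + m * (n * n)))

/-- The matrix of voter `w` has a one in row `a` and column `b`. -/
def Entry (x : List Bool) (n m w a b : ℕ) : Prop :=
  x.getD (n + (m + (2 + (n * (w * n + a) + b)))) false = true

theorem HasHeader.lt_length {x : List Bool} {n m : ℕ} (h : HasHeader x n m) :
    n < x.length ∧ m < x.length := by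
  have := h.2.2.2.2
  generalize m * (n * n) = k at this
  omega

/-- Division with remainder by `n`, done twice, writes each position after the header as voter, row
and column. -/
theorem HasHeader.ext {x y : List Bool} {n m : ℕ} (hx : HasHeader x n m) (hy : HasHeader y n m)
    (h : ∀ w < m, ∀ a < n, ∀ b < n, Entry x n m w a b ↔ Entry y n m w a b) : x = y := by
  obtain ⟨x1, x2, x3, x4, x5⟩ := hx
  obtain ⟨y1, y2, y3, y4, y5⟩ := hy
  have key : ∀ i < x.length, (x.getD i false = true ↔ y.getD i false = true) := by
    intro i hi
    rcases lt_trichotomy i n with h1 | rfl | h1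
    · simp only [x1 i h1, y1 i h1]
    · simp only [x2, y2]
    · obtain ⟨j, rfl⟩ : ∃ j, i = n + (1 + j) := ⟨i - (n + 1), by omega⟩
      rcases lt_trichotomy j m with h2 | rfl | h2
      · simp only [x3 j h2, y3 j h2]
      · simp only [x4, y4]
      · obtain ⟨k, rfl⟩ : ∃ k, j = m + (1 + k) := ⟨j - (m + 1), by omega⟩
        have hk : k < m * n * n := by rw [Nat.mul_assoc]; omega
        have hn : 0 < n := by
          rcases Nat.eq_zero_or_pos n with rfl | hn
          · simp at hk
          · exact hn
        have hq : k / n < m * n := (Nat.div_lt_iff_lt_mul hn).2 hk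
        have hw : k / n / n < m := (Nat.div_lt_iff_lt_mul hn).2 hq
        have e := h _ hw _ (Nat.mod_lt (k / n) hn) _ (Nat.mod_lt k hn)
        have e' : n + (m + (2 + (n * (k / n / n * n + k / n % n) + k % n))) =
            n + (1 + (m + (1 + k))) := by
          rw [Nat.div_add_mod', Nat.div_add_mod]; omega
        rwa [Entry, Entry, e'] at e
  refine List.ext_getElem (x5.trans y5.symm) fun i h1 h2 => ?_
  have := key i h1
  rw [List.getD_eq_getElem _ _ h1, List.getD_eq_getElem _ _ h2] at this
  exact Bool.eq_iff_iff.2 this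

theorem ProfileInput.hasHeader_encode (I : ProfileInput) :
    HasHeader I.encode I.numCandidates I.voters.length := by
  have hl : (I.voters.flatMap WeakOrder.encode).length =
      I.voters.length * (I.numCandidates * I.numCandidates) := by
    simp [List.length_flatMap, WeakOrder.encode_length]
  unfold ProfileInput.encode
  refine ⟨fun i hi => ?_, ?_, fun i hi => ?_, ?_, ?_⟩
  · rw [List.getD_append _ _ _ _ (by simpa using hi)]
    simp [hi]
  · rw [List.getD_append_right _ _ _ _ (by simp)]
    simp
  · rw [List.getD_append_right _ _ _ _ (by simp), List.length_replicate, Nat.add_sub_cancel_left,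
      Nat.add_comm 1, List.getD_cons_succ, List.getD_append _ _ _ _ (by simpa using hi)]
    simp [hi]
  · rw [List.getD_append_right _ _ _ _ (by simp), List.length_replicate, Nat.add_sub_cancel_left,
      Nat.add_comm 1, List.getD_cons_succ, List.getD_append_right _ _ _ _ (by simp)]
    simp
  · simp [hl]
    omega

theorem ProfileInput.entry_encode (I : ProfileInput) (w : ℕ) (hw : w < I.voters.length)
    (a b : Fin I.numCandidates) :
    Entry I.encode I.numCandidates I.voters.length w a b ↔ (I.voters[w]).prefers a b := by
  obtain ⟨n, V⟩ := I
  dsimp only at *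
  have e1 : n * (w * n + a) + b = n * n * w + (n * a + b) := by ring
  have hab : n * a + b < n * n := by
    have := a.2
    have := b.2
    nlinarith
  unfold Entry ProfileInput.encode
  dsimp only
  rw [List.getD_append_right _ _ _ _ (by simp), List.length_replicate, Nat.add_sub_cancel_left,
    show V.length + (2 + (n * (w * n + a) + b)) = (V.length + (1 + (n * (w * n + a) + b))) + 1 by
      omega, List.getD_cons_succ, List.getD_append_right _ _ _ _ (by simp), List.length_replicate,
    Nat.add_sub_cancel_left, Nat.add_comm 1, List.getD_cons_succ, e1,
    List.getD_flatMap_of_length WeakOrder.encode false (n * n) V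
      (fun v _ => v.encode_length) w _ hw hab, WeakOrder.encode,
    List.getD_flatMap_of_length _ false n (List.finRange n) (by simp) a b (by simp) b.2]
  simp

/-! ### Single-peakedness in terms of the matrix entries -/

/-- The numbers `s` and `t` agree if cut off at `N`. -/
def EqUpTo (N s t : ℕ) : Prop := min s N ≤ t ∧ min t N ≤ s

/-- Programs compare numbers only after truncation at the length of the word, so the conditions
below use `EqUpTo`. All the numbers that matter are small enough for it to be equality. -/
theorem eqUpTo_iff {N s t : ℕ} (hs : s < N) : EqUpTo N s t ↔ s = t := by
  unfold EqUpTo; omega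

/-- All voters have weak orders with a peak. -/
def EntriesValid (x : List Bool) (n m : ℕ) : Prop :=
  ∀ w < m, (∃ p < n, ∀ c < n, ¬ EqUpTo x.length c p → Entry x n m w p c) ∧
    (∀ a < n, ¬ Entry x n m w a a) ∧
    ∀ a < n, ∀ b < n, ∀ c < n,
      (Entry x n m w a b → Entry x n m w b c → Entry x n m w a c) ∧
      ((¬ Entry x n m w a b ∧ ¬ Entry x n m w b a) → (¬ Entry x n m w b c ∧ ¬ Entry x n m w c b) →
        (¬ Entry x n m w a c ∧ ¬ Entry x n m w c a))

def EntriesDiffer (x : List Bool) (n m v a b : ℕ) : Prop :=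
  ¬ EqUpTo x.length a b ∧ ((¬ Entry x n m v a b ∧ ¬ Entry x n m v b a) ∨
    ∃ c < n, ¬ EqUpTo x.length c a ∧ ¬ EqUpTo x.length c b ∧ ¬ Entry x n m v a b ∧
      ¬ Entry x n m v b c ∧ ∃ w < m, ¬ Entry x n m w b a ∧ ¬ Entry x n m w b c)

def EntriesAgree (x : List Bool) (n m v a b : ℕ) : Prop :=
  ∃ c < n, ¬ EqUpTo x.length c a ∧ ¬ EqUpTo x.length c b ∧ ¬ Entry x n m v a b ∧
    ¬ Entry x n m v b c ∧ ∃ w < m, ¬ Entry x n m w c a ∧ ¬ Entry x n m w c b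

/-- The relation `SideLink`, where `a` and `n + a` stand for the two sides of `a`. -/
def EntriesLink (x : List Bool) (n m v i j : ℕ) : Prop :=
  ∃ a < n, ∃ b < n,
    ((EntriesAgree x n m v a b ∨ EntriesAgree x n m v b a) ∧
      ((EqUpTo x.length i a ∧ EqUpTo x.length j b) ∨
        (EqUpTo x.length i (n + a) ∧ EqUpTo x.length j (n + b)))) ∨
    ((EntriesDiffer x n m v a b ∨ EntriesDiffer x n m v b a) ∧
      ((EqUpTo x.length i a ∧ EqUpTo x.length j (n + b)) ∨
        (EqUpTo x.length i (n + a) ∧ EqUpTo x.length j b)))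

/-- The sides of the candidates can be chosen consistently. -/
def EntriesConsistent (x : List Bool) (n m : ℕ) : Prop :=
  ∀ v < m, ∀ c < n, ¬ (c < x.length ∧ n + c < x.length ∧
    Relation.ReflTransGen (fun i j => i < x.length ∧ j < x.length ∧ EntriesLink x n m v i j)
      c (n + c))

/-! ### The conditions on the entries, evaluated on the code of a profile. -/

section Correct

open Relation

variable {I : ProfileInput}

theorem entriesValid_encode :
    EntriesValid I.encode I.numCandidates I.voters.length ↔ ∀ w ∈ I.voters, ∃ p, w.IsPeak p := by
  have hn : I.numCandidates < I.encode.length := I.hasHeader_encode.lt_length.1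
  constructor
  · intro h w hw
    obtain ⟨i, hi, rfl⟩ := List.getElem_of_mem hw
    obtain ⟨⟨p, hp, hpc⟩, -⟩ := h i hi
    refine ⟨⟨p, hp⟩, fun c hc => ?_⟩
    rw [← I.entry_encode i hi]
    refine hpc c c.2 ?_
    rw [eqUpTo_iff (c.2.trans hn)]
    exact fun e => hc (Fin.ext e)
  · intro h w hw
    have e := I.entry_encode w hw
    refine ⟨?_, ?_, ?_⟩
    · obtain ⟨p, hp⟩ := h _ (List.getElem_mem hw)
      refine ⟨p, p.2, fun c hc hcp => ?_⟩
      have := (e p ⟨c, hc⟩).2 (hp _ ?_)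
      · exact this
      · rintro rfl
        exact hcp ((eqUpTo_iff (hc.trans hn)).2 rfl)
    · intro a ha
      exact fun h => (I.voters[w]).irrefl ⟨a, ha⟩ ((e ⟨a, ha⟩ ⟨a, ha⟩).1 h)
    · intro a ha b hb c hc
      have eab := e ⟨a, ha⟩ ⟨b, hb⟩
      have eba := e ⟨b, hb⟩ ⟨a, ha⟩
      have ebc := e ⟨b, hb⟩ ⟨c, hc⟩
      have ecb := e ⟨c, hc⟩ ⟨b, hb⟩
      have eac := e ⟨a, ha⟩ ⟨c, hc⟩
      have eca := e ⟨c, hc⟩ ⟨a, ha⟩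
      dsimp only at eab eba ebc ecb eac eca
      rw [eab, eba, ebc, ecb, eac, eca]
      exact ⟨(I.voters[w]).trans _ _ _, (I.voters[w]).indiff_trans _ _ _⟩

theorem exists_voter_encode (P : WeakOrder (Fin I.numCandidates) → Prop) (P' : ℕ → Prop)
    (h : ∀ w (hw : w < I.voters.length), P' w ↔ P I.voters[w]) :
    (∃ w < I.voters.length, P' w) ↔
      ∃ w ∈ (I.voters : Multiset (WeakOrder (Fin I.numCandidates))), P w := by
  constructor
  · rintro ⟨w, hw, hP⟩
    exact ⟨_, by simp, (h w hw).1 hP⟩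
  · rintro ⟨w, hw, hP⟩
    obtain ⟨i, hi, rfl⟩ := List.getElem_of_mem (Multiset.mem_coe.1 hw)
    exact ⟨i, hi, (h i hi).2 hP⟩

theorem eqUpTo_encode (a b : Fin I.numCandidates) : EqUpTo I.encode.length a b ↔ a = b := by
  rw [eqUpTo_iff (a.2.trans I.hasHeader_encode.lt_length.1), Fin.ext_iff]

theorem entriesDiffer_encode (v : ℕ) (hv : v < I.voters.length) (a b : Fin I.numCandidates) :
    EntriesDiffer I.encode I.numCandidates I.voters.length v a b ↔
      MustDiffer I.voters[v] I.voters a b := by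
  unfold EntriesDiffer MustDiffer
  rw [eqUpTo_encode, I.entry_encode v hv, I.entry_encode v hv, Fin.exists_iff]
  refine and_congr Iff.rfl (or_congr Iff.rfl (exists_congr fun c => ?_))
  rw [← exists_prop]
  refine exists_congr fun hc => ?_
  refine and_congr (not_congr (eqUpTo_encode ⟨c, hc⟩ a)) (and_congr
    (not_congr (eqUpTo_encode ⟨c, hc⟩ b)) (and_congr Iff.rfl (and_congr
      (not_congr (I.entry_encode v hv b ⟨c, hc⟩)) ?_)))
  exact exists_voter_encode _ _ fun w hw => and_congr (not_congr (I.entry_encode w hw b a))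
    (not_congr (I.entry_encode w hw b ⟨c, hc⟩))

theorem entriesAgree_encode (v : ℕ) (hv : v < I.voters.length) (a b : Fin I.numCandidates) :
    EntriesAgree I.encode I.numCandidates I.voters.length v a b ↔
      MustAgree I.voters[v] I.voters a b := by
  unfold EntriesAgree MustAgree
  rw [I.entry_encode v hv, Fin.exists_iff]
  refine exists_congr fun c => ?_
  rw [← exists_prop]
  refine exists_congr fun hc => ?_
  refine and_congr (not_congr (eqUpTo_encode ⟨c, hc⟩ a)) (and_congr
    (not_congr (eqUpTo_encode ⟨c, hc⟩ b)) (and_congr Iff.rfl (and_congr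
      (not_congr (I.entry_encode v hv b ⟨c, hc⟩)) ?_)))
  exact exists_voter_encode _ _ fun w hw => and_congr (not_congr (I.entry_encode w hw ⟨c, hc⟩ a))
    (not_congr (I.entry_encode w hw ⟨c, hc⟩ b))

/-- The number that stands for a side of a candidate. -/
def sideNumber {k : ℕ} (y : Fin k × Bool) : ℕ := if y.2 then y.1 else k + y.1

theorem sideNumber_injective {k : ℕ} : Function.Injective (sideNumber (k := k)) := by
  rintro ⟨a, _ | _⟩ ⟨b, _ | _⟩ h
  · simp [sideNumber] at h; simp [Fin.ext h]
  · have := b.2; simp [sideNumber] at h; omega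
  · have := a.2; simp [sideNumber] at h; omega
  · simp [sideNumber] at h; simp [Fin.ext h]

theorem entriesLink_encode (v : ℕ) (hv : v < I.voters.length) (i j : ℕ) (hi : i < I.encode.length)
    (hj : j < I.encode.length) :
    EntriesLink I.encode I.numCandidates I.voters.length v i j ↔ ∃ y z : Fin I.numCandidates × Bool,
      i = sideNumber y ∧ j = sideNumber z ∧ SideLink I.voters[v] I.voters y z := by
  unfold EntriesLink
  simp only [eqUpTo_iff hi, eqUpTo_iff hj]
  constructor
  · rintro ⟨a, ha, b, hb, ⟨h, h'⟩ | ⟨h, h'⟩⟩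
    · have h := (or_congr (entriesAgree_encode v hv ⟨a, ha⟩ ⟨b, hb⟩)
        (entriesAgree_encode v hv ⟨b, hb⟩ ⟨a, ha⟩)).1 h
      rcases h' with ⟨rfl, rfl⟩ | ⟨rfl, rfl⟩
      · exact ⟨(⟨_, ha⟩, true), (⟨_, hb⟩, true), by simp [sideNumber], by simp [sideNumber],
          by simpa [SideLink] using h⟩
      · exact ⟨(⟨_, ha⟩, false), (⟨_, hb⟩, false), by simp [sideNumber], by simp [sideNumber],
          by simpa [SideLink] using h⟩
    · have h := (or_congr (entriesDiffer_encode v hv ⟨a, ha⟩ ⟨b, hb⟩)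
        (entriesDiffer_encode v hv ⟨b, hb⟩ ⟨a, ha⟩)).1 h
      rcases h' with ⟨rfl, rfl⟩ | ⟨rfl, rfl⟩
      · exact ⟨(⟨_, ha⟩, true), (⟨_, hb⟩, false), by simp [sideNumber], by simp [sideNumber],
          by simpa [SideLink] using h⟩
      · exact ⟨(⟨_, ha⟩, false), (⟨_, hb⟩, true), by simp [sideNumber], by simp [sideNumber],
          by simpa [SideLink] using h⟩
  · rintro ⟨⟨a, s⟩, ⟨b, t⟩, rfl, rfl, h⟩
    refine ⟨a, a.2, b, b.2, ?_⟩
    rw [entriesAgree_encode v hv, entriesAgree_encode v hv, entriesDiffer_encode v hv,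
      entriesDiffer_encode v hv]
    cases s <;> cases t <;> simp [SideLink, sideNumber] at h ⊢ <;> simp [h]

theorem entriesConsistent_encode :
    EntriesConsistent I.encode I.numCandidates I.voters.length ↔
      ∀ v (hv : v < I.voters.length), ∀ c,
      ¬ ReflTransGen (SideLink I.voters[v] I.voters) (c, true) (c, false) := by
  refine forall_congr' fun v => forall_congr' fun hv => ?_
  have hN : ∀ y : Fin I.numCandidates × Bool, sideNumber y < I.encode.length := by
    rintro ⟨a, s⟩
    have h1 := a.2
    have h2 := I.hasHeader_encode.2.2.2.2
    -- There is at least one voter, so its matrix makes the word long enough for all `n + n` side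
    -- numbers to be positions.
    have h3 : I.numCandidates * 1 ≤ I.voters.length * (I.numCandidates * I.numCandidates) := by
      rw [Nat.mul_one]
      exact (Nat.le_mul_self _).trans (Nat.le_mul_of_pos_left _ (by omega))
    generalize I.voters.length * (I.numCandidates * I.numCandidates) = k at h2 h3
    cases s <;> simp [sideNumber] <;> omega
  have key : ∀ y z : Fin I.numCandidates × Bool,
      ReflTransGen (fun i j => i < I.encode.length ∧ j < I.encode.length ∧
          EntriesLink I.encode I.numCandidates I.voters.length v i j)
        (sideNumber y) (sideNumber z) ↔ ReflTransGen (SideLink I.voters[v] I.voters) y z := by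
    intro y z
    constructor
    · have : ∀ j, ReflTransGen
          (fun i j => i < I.encode.length ∧ j < I.encode.length ∧
          EntriesLink I.encode I.numCandidates I.voters.length v i j)
          (sideNumber y) j → ∃ z, j = sideNumber z ∧
            ReflTransGen (SideLink I.voters[v] I.voters) y z := by
        intro j h
        induction h with
        | refl => exact ⟨y, rfl, .refl⟩
        | tail _ h ih =>
          obtain ⟨z, rfl, hz⟩ := ih
          obtain ⟨y', z', h1, h2, h3⟩ := (entriesLink_encode v hv _ _ h.1 h.2.1).1 h.2.2
          rw [← sideNumber_injective h1] at h3
          exact ⟨z', h2, hz.tail h3⟩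
      intro h
      obtain ⟨z', h1, h2⟩ := this _ h
      rwa [sideNumber_injective h1]
    · intro h
      exact h.lift sideNumber fun y z h => ⟨hN y, hN z,
        (entriesLink_encode v hv _ _ (hN y) (hN z)).2 ⟨y, z, rfl, rfl, h⟩⟩
  constructor
  · intro h c hc
    exact h c c.2 ⟨hN (c, true), hN (c, false), (key (c, true) (c, false)).2 hc⟩
  · rintro h c hc ⟨-, -, h'⟩
    exact h ⟨c, hc⟩ ((key (⟨c, hc⟩, true) (⟨c, hc⟩, false)).1 h')

theorem singlePeaked_encode_iff :
    SinglePeaked (I.voters : Multiset (WeakOrder (Fin I.numCandidates))) ↔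
      EntriesValid I.encode I.numCandidates I.voters.length ∧
        EntriesConsistent I.encode I.numCandidates I.voters.length := by
  rw [entriesValid_encode, entriesConsistent_encode]
  -- Without voters there is no reference voter, but then any listing is an axis and the conditions
  -- on the entries are vacuous.
  rcases Nat.eq_zero_or_pos I.voters.length with h0 | h0
  · have h1 : I.voters = [] := List.length_eq_zero_iff.1 h0
    constructor
    · intro _
      exact ⟨by simp [h1], fun v hv => absurd hv (by omega)⟩
    · intro _
      exact ⟨List.finRange _, ⟨List.nodup_finRange _, by simp⟩, by simp [h1]⟩
  · constructor
    · intro h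
      refine ⟨fun w hw => ((singlePeaked_iff_not_reachable (v := I.voters[0])
        (by simp)).1 h).1 w (by simpa using hw), fun v hv => ?_⟩
      exact ((singlePeaked_iff_not_reachable (v := I.voters[v]) (by simp)).1 h).2
    · rintro ⟨h1, h2⟩
      -- One reference voter is enough here; testing all of them in `EntriesConsistent` spares the
      -- program a case distinction for `m = 0`.
      exact (singlePeaked_iff_not_reachable (v := I.voters[0]) (by simp)).2
        ⟨fun w hw => h1 w (by simpa using hw), h2 0 h0⟩

end Correct

/-- The voters are read off the matrices, and `EntriesValid` supplies the axioms of a weak order.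
This is what lets the program reject words that are not codes. -/
theorem exists_encode_eq {x : List Bool} {n m : ℕ} (hx : HasHeader x n m)
    (hv : EntriesValid x n m) :
    ∃ I : ProfileInput, I.numCandidates = n ∧ I.voters.length = m ∧ I.encode = x := by
  let voter : Fin m → WeakOrder (Fin n) := fun w =>
    { prefers := fun a b => Entry x n m w a b
      irrefl := fun a => (hv w w.2).2.1 a a.2
      trans := fun a b c => ((hv w w.2).2.2 a a.2 b b.2 c c.2).1
      indiff_trans := fun a b c => ((hv w w.2).2.2 a a.2 b b.2 c c.2).2 }
  let I : ProfileInput := ⟨n, List.ofFn voter⟩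
  have hm : I.voters.length = m := List.length_ofFn
  refine ⟨I, rfl, hm, ?_⟩
  have h1 := I.hasHeader_encode
  rw [hm] at h1
  have h2 : ∀ k, I.voters.length = k → ∀ (w : ℕ) (hw : w < I.voters.length) (a b : Fin n),
      (Entry I.encode n k w a b ↔ (I.voters[w]).prefers a b) := by
    rintro _ rfl
    exact I.entry_encode
  refine HasHeader.ext h1 hx fun w hw a ha b hb => ?_
  rw [h2 m hm w (hm.symm ▸ hw) ⟨a, ha⟩ ⟨b, hb⟩]
  simp [I, voter]

theorem mem_singlePeakedLanguage_iff (x : List Bool) :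
    x ∈ singlePeakedLanguage ↔ ∃ n < x.length, ∃ m < x.length,
      HasHeader x n m ∧ EntriesValid x n m ∧ EntriesConsistent x n m := by
  constructor
  · rintro ⟨I, hI, rfl⟩
    exact ⟨_, I.hasHeader_encode.lt_length.1, _, I.hasHeader_encode.lt_length.2,
      I.hasHeader_encode, singlePeaked_encode_iff.1 hI⟩
  · rintro ⟨n, -, m, -, h1, h2, h3⟩
    obtain ⟨I, rfl, rfl, rfl⟩ := exists_encode_eq h1 h2
    exact ⟨I, singlePeaked_encode_iff.2 ⟨h2, h3⟩, rfl⟩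

/-! ### The recognition program -/

namespace Decides

variable {Q : List Bool → Prop} {d : ℕ}

theorem eqUpTo (t u : NumTerm) :
    Decides Q d fun x ρ => EqUpTo x.length (t.eval x.length ρ) (u.eval x.length ρ) :=
  (le t u).and (le u t)

theorem eqUpTo_var (a b : ℕ) : Decides Q d fun x ρ => EqUpTo x.length (ρ a) (ρ b) :=
  eqUpTo (.var a) (.var b)

theorem eqUpTo_add (i a : ℕ) : Decides Q d fun x ρ => EqUpTo x.length (ρ i) (ρ 0 + ρ a) :=
  eqUpTo (.var i) (.add (.var 0) (.var a))

theorem entry (w a b : ℕ) :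
    Decides Q d fun x ρ => Entry x (ρ 0) (ρ 1) (ρ w) (ρ a) (ρ b) :=
  bit (.add (.var 0) (.add (.var 1) (.add (.const 2)
    (.add (.mul 0 (.add (.mul w (.var 0)) (.var a))) (.var b)))))

theorem hasHeader : Decides Q 2 fun x ρ => HasHeader x (ρ 0) (ρ 1) := by
  have h1 : Decides Q 2 _ := forall_lt_var (by norm_num) (bit (d := 3) (.var 2)) (i := 0)
    (by norm_num)
  have h2 : Decides Q 2 _ := forall_lt_var (by norm_num)
    (bit (d := 3) (.add (.var 0) (.add (.const 1) (.var 2)))) (i := 1) (by norm_num)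
  have h3 := h1.and ((bit (.var 0)).not.and (h2.and
    ((bit (.add (.var 0) (.add (.const 1) (.var 1)))).not.and
      -- `le` truncates its left term at the length, so a test with the length on the right is
      -- always true. The equation for the length is therefore expressed as "at most the value, but
      -- not at most the value minus one", with `.const 1` in the second term.
      ((le .len (.add (.var 0) (.add (.var 1) (.add (.const 2) (.mul 1 (.mul 0 (.var 0))))))).and
        (le .len (.add (.var 0) (.add (.var 1) (.add (.const 1)
          (.mul 1 (.mul 0 (.var 0))))))).not))))
  refine h3.congr fun x ρ => ?_
  simp only [HasHeader, NumTerm.eval, Function.update_apply, min_self]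
  norm_num
  intros
  omega

theorem entriesValid : Decides Q 2 fun x ρ => EntriesValid x (ρ 0) (ρ 1) := by
  have h1 : Decides Q 3 _ := exists_lt_var (by norm_num) (forall_lt_var (by norm_num)
    ((eqUpTo_var (d := 5) 4 3).not.imp (entry 2 3 4)) (i := 0) (by norm_num)) (i := 0) (by norm_num)
  have h2 : Decides Q 3 _ := forall_lt_var (by norm_num) (entry (d := 4) 2 3 3).not (i := 0)
    (by norm_num)
  have h3 : Decides Q 3 _ := forall_lt_var (by norm_num) (forall_lt_var (by norm_num)
    (forall_lt_var (by norm_num)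
      (((entry (d := 6) 2 3 4).imp ((entry 2 4 5).imp (entry 2 3 5))).and
        (((entry 2 3 4).not.and (entry 2 4 3).not).imp
          (((entry 2 4 5).not.and (entry 2 5 4).not).imp ((entry 2 3 5).not.and (entry 2 5 3).not))))
      (i := 0) (by norm_num)) (i := 0) (by norm_num)) (i := 0) (by norm_num)
  have h4 : Decides Q 2 _ := forall_lt_var (by norm_num) (h1.and (h2.and h3)) (i := 1) (by norm_num)
  refine h4.congr fun x ρ => ?_
  simp [EntriesValid]

/-- Allotment of the variables in the reachability test: 0 and 1 hold `n` and `m`, 2 the reference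
voter, 3 the candidate under test, 4 and 5 the ends of an edge, 6 and 7 the candidates of a
constraint, 8 the third candidate and 9 the other voter. -/
theorem entriesDiffer {a b : ℕ} (ha : a < 8) (hb : b < 8) :
    Decides Q 8 fun x ρ => EntriesDiffer x (ρ 0) (ρ 1) (ρ 2) (ρ a) (ρ b) := by
  have h1 : Decides Q 9 _ := exists_lt_var (by norm_num)
    ((entry (d := 10) 9 b a).not.and (entry 9 b 8).not) (i := 1) (by norm_num)
  have h2 : Decides Q 8 _ := exists_lt_var (by norm_num) ((eqUpTo_var 8 a).not.and
    ((eqUpTo_var 8 b).not.and ((entry 2 a b).not.and ((entry 2 b 8).not.and h1)))) (i := 0)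
    (by norm_num)
  have h3 := (eqUpTo_var a b).not.and (((entry 2 a b).not.and (entry 2 b a).not).or h2)
  refine h3.congr fun x ρ => ?_
  have a8 : a ≠ 8 := by omega
  have b8 : b ≠ 8 := by omega
  have a9 : a ≠ 9 := by omega
  have b9 : b ≠ 9 := by omega
  simp [EntriesDiffer, a8, b8, a9, b9]

theorem entriesAgree {a b : ℕ} (ha : a < 8) (hb : b < 8) :
    Decides Q 8 fun x ρ => EntriesAgree x (ρ 0) (ρ 1) (ρ 2) (ρ a) (ρ b) := by
  have h1 : Decides Q 9 _ := exists_lt_var (by norm_num)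
    ((entry (d := 10) 9 8 a).not.and (entry 9 8 b).not) (i := 1) (by norm_num)
  have h2 : Decides Q 8 _ := exists_lt_var (by norm_num) ((eqUpTo_var 8 a).not.and
    ((eqUpTo_var 8 b).not.and ((entry 2 a b).not.and ((entry 2 b 8).not.and h1)))) (i := 0)
    (by norm_num)
  refine h2.congr fun x ρ => ?_
  have a8 : a ≠ 8 := by omega
  have b8 : b ≠ 8 := by omega
  have a9 : a ≠ 9 := by omega
  have b9 : b ≠ 9 := by omega
  simp [EntriesAgree, a8, b8, a9, b9]

theorem entriesLink : Decides Q 6 fun x ρ => EntriesLink x (ρ 0) (ρ 1) (ρ 2) (ρ 4) (ρ 5) := by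
  have h6 : 6 < 8 := by norm_num
  have h7 : 7 < 8 := by norm_num
  have h : Decides Q 6 _ := exists_lt_var (by norm_num) (exists_lt_var (by norm_num)
    ((((entriesAgree h6 h7).or (entriesAgree h7 h6)).and
      (((eqUpTo_var 4 6).and (eqUpTo_var 5 7)).or ((eqUpTo_add 4 6).and (eqUpTo_add 5 7)))).or
    (((entriesDiffer h6 h7).or (entriesDiffer h7 h6)).and
      (((eqUpTo_var 4 6).and (eqUpTo_add 5 7)).or ((eqUpTo_add 4 6).and (eqUpTo_var 5 7)))))
    (i := 0) (by norm_num)) (i := 0) (by norm_num)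
  refine h.congr fun x ρ => ?_
  simp [EntriesLink]

theorem entriesConsistent :
    Decides (fun a => ∀ b ∈ a, b = false) 2 fun x ρ => EntriesConsistent x (ρ 0) (ρ 1) := by
  have h : Decides (fun a => ∀ b ∈ a, b = false) 2 _ := forall_lt_var (by norm_num)
    (forall_lt_var (by norm_num) (reach (d := 4) (by norm_num) entriesLink (.var 3)
      (.add (.var 0) (.var 3))).not (i := 0) (by norm_num)) (i := 1) (by norm_num)
  refine h.congr fun x ρ => ?_
  simp [EntriesConsistent, NumTerm.eval]

end Decides

/-- Deciding whether a given profile of weak orders is single-peaked is in P. -/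
theorem theorem6 : InP singlePeakedLanguage := by
  have h : Decides (fun a => ∀ b ∈ a, b = false) 0 _ :=
    Decides.exists_lt_len (by norm_num) (Decides.exists_lt_len (by norm_num)
      (Decides.hasHeader.and (Decides.entriesValid.and Decides.entriesConsistent)))
  refine inP_of_decides h fun x => ?_
  rw [mem_singlePeakedLanguage_iff]
  simp
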